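/- Let $n\ge 1$ be an integer and let $\Delta^n=\{x=(x_0,\dots,x_n)\in\mathbb{R}^{n+1} : x_0,\dots,x_n>0,\ \sum_{j=0}^n x_j=1\}$ be the (open) regular simplex, equipped with Lebesgue measure $dx$, normalized so that the projection $(x_0,\dots,x_n)\mapsto(x_1,\dots,x_n)$ is measure preserving. For $i,j\in\{0,\dots,n\}$ let $E^{ij}f=\left(\frac{\partial}{\partial x_i}-\frac{\partial}{\partial x_j}\right)f$ denote the derivative of $f$ in the direction $e_i-e_j$, which is tangent to $\Delta^n$; for Lipschitz $f$ it exists at almost every point of $\Delta^n$. Then for every Lipschitz function $f:\Delta^n\to\mathbb{R}$ with $\int_{\Delta^n} f\,dx=0$, the function $$G_f(x)=\left(\sum_{k=0}^n\frac{x_k^2}{1-2x_k}\right)^{-1}\sum_{0\le i<j\le n}\frac{x_i^2x_j^2}{(1-2x_i)(1-2x_j)}\,\left|E^{ij}f(x)\right|^2$$ is non-negative for almost every $x\in\Delta^n$, and $$\int_{\Delta^n} f^2(x)\,dx\ \le\ 4\int_{\Delta^n} G_f(x)\,dx ,$$ where the right-hand side is a Lebesgue integral with values in $[0,+\infty]$.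 -/

import Mathlib

open MeasureTheory

/-- The open simplex `Δⁿ = {x ∈ ℝ₊ⁿ⁺¹ : ∑ x_j = 1}`, where `ℝ₊ⁿ⁺¹` is the orthant of the vectors
with (strictly) positive coordinates. -/
def openSimplex (n : ℕ) : Set (Fin (n + 1) → ℝ) :=
  {x | (∀ k, 0 < x k) ∧ ∑ k, x k = 1}

/-- The open simplex in `ℝⁿ` with vertices `0, e_1, …, e_n`. -/
def cornerSimplex (n : ℕ) : Set (Fin n → ℝ) :=
  {y | (∀ i, 0 < y i) ∧ ∑ i, y i < 1}

/-- The map `(y_1, …, y_n) ↦ (1 - ∑ y_i, y_1, …, y_n)`; on the corner simplex it is the inverse of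
the projection `(x_0, …, x_n) ↦ (x_1, …, x_n)` of `Δⁿ`. -/
def simplexLift (n : ℕ) (y : Fin n → ℝ) : Fin (n + 1) → ℝ :=
  Fin.cons (1 - ∑ i, y i) y

/-- The Lebesgue measure on `Δⁿ`, as a measure on `ℝⁿ⁺¹` carried by `Δⁿ`. It is normalized so that
the projection `(x_0, …, x_n) ↦ (x_1, …, x_n)` preserves measure. -/
noncomputable def simplexMeasure (n : ℕ) : Measure (Fin (n + 1) → ℝ) :=
  (volume.restrict (cornerSimplex n)).map (simplexLift n)

/-- `E^{ij} f (x) = (∂/∂x_i - ∂/∂x_j) f (x)`, the derivative of `f` at `x` in the direction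
`e_i - e_j`. This direction is tangent to `Δⁿ`, so for `x ∈ Δⁿ` only the values of `f` on `Δⁿ`
matter. -/
noncomputable def edgeDeriv {n : ℕ} (f : (Fin (n + 1) → ℝ) → ℝ) (i j : Fin (n + 1))
    (x : Fin (n + 1) → ℝ) : ℝ :=
  lineDeriv ℝ f x (Pi.single i 1 - Pi.single j 1)

/-- The integrand
`(∑ₖ xₖ² / (1 - 2 xₖ))⁻¹ ∑_{i<j} xᵢ² xⱼ² / ((1 - 2 xᵢ) (1 - 2 xⱼ)) |E^{ij} f (x)|²`,
where the sum runs over the `n (n + 1) / 2` unordered pairs of distinct indices. -/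
noncomputable def simplexEnergy {n : ℕ} (f : (Fin (n + 1) → ℝ) → ℝ)
    (x : Fin (n + 1) → ℝ) : ℝ :=
  (∑ k, x k ^ 2 / (1 - 2 * x k))⁻¹ *
    ∑ p : Fin (n + 1) × Fin (n + 1) with p.1 < p.2,
      x p.1 ^ 2 * x p.2 ^ 2 / ((1 - 2 * x p.1) * (1 - 2 * x p.2)) * |edgeDeriv f p.1 p.2 x| ^ 2

theorem measurable_simplexLift (n : ℕ) : Measurable (simplexLift n) := by
  refine measurable_pi_lambda _ fun k => ?_
  refine Fin.cases ?_ (fun i => ?_) k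
  · simp only [simplexLift, Fin.cons_zero]
    fun_prop
  · simp only [simplexLift, Fin.cons_succ]
    fun_prop

theorem simplexLift_mem (n : ℕ) {y : Fin n → ℝ} (hy : y ∈ cornerSimplex n) :
    simplexLift n y ∈ openSimplex n := by
  refine ⟨fun k => ?_, ?_⟩
  · refine Fin.cases ?_ (fun i => ?_) k
    · simpa [simplexLift] using hy.2
    · simpa [simplexLift] using hy.1 i
  · simp [simplexLift, Fin.sum_univ_succ]

theorem simplexLift_tail (n : ℕ) {x : Fin (n + 1) → ℝ} (hx : x ∈ openSimplex n) :
    Fin.tail x ∈ cornerSimplex n ∧ simplexLift n (Fin.tail x) = x := by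
  have h := hx.2
  rw [Fin.sum_univ_succ] at h
  have h0 := hx.1 0
  refine ⟨⟨fun i => hx.1 i.succ, ?_⟩, ?_⟩
  · simp only [Fin.tail]
    linarith
  · have h1 : 1 - ∑ i, Fin.tail x i = x 0 := by
      simp only [Fin.tail]
      linarith
    rw [simplexLift, h1, Fin.cons_self_tail]

/-- The projection of `Δⁿ` onto the corner simplex preserves measure. -/
theorem map_tail_simplexMeasure (n : ℕ) :
    (simplexMeasure n).map Fin.tail = volume.restrict (cornerSimplex n) := by
  have ht : Measurable (Fin.tail : (Fin (n + 1) → ℝ) → Fin n → ℝ) :=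
    measurable_pi_lambda _ fun i => measurable_pi_apply i.succ
  rw [simplexMeasure, Measure.map_map ht (measurable_simplexLift n)]
  exact Measure.map_id

/-!
The simplex is parametrized by `y = (x₁, …, xₙ)` in the corner simplex, with `x₀ = 1 - ∑ yᵢ`. The
proof is a dual Bochner (Hörmander `L²`) argument for the Jacobi (Wright–Fisher) operator
`L u = div (A ∇u)`, `A = diag y - y yᵀ`, which is symmetric for Lebesgue measure.

Write `e = ∑ yₖ ∂ₖu`, `cᵢ = ∂ᵢu - e` for `i ≥ 1` and `c₀ = -e`, so that `V = A ∇u` has the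
components `xₖ cₖ`, and `Γ = ∑ xₖ cₖ²` (sums over `k ≥ 0`). Three facts carry the argument.

* `L` maps the polynomials onto the polynomials modulo constants (`exists_jacobiOp_eq`), because on
  a monomial of degree `d` it is multiplication by `-d (n + d)` plus terms of lower degree.
* For every polynomial `u`, `∫ ∑ₖ cₖ² (1 - 2 xₖ) ≤ 4 ∫ (L u)²` (`integral_bochner`). Since `V` is
  tangent to the flat facets, `∫ (div V)² = ∫ tr (B²)` with `B = DV`. Now `B = T + A D²u`, where
  `Tᵢⱼ = δᵢⱼ cᵢ - yᵢ ∂ⱼu` is again `A` times a symmetric matrix; as `A` is positive semidefinite,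
  `tr ((B - T/2)²) ≥ 0` (`trace_hessian_nonneg`). One more integration by parts evaluates
  `∫ tr (B T) = ½ ∫ ∑ₖ cₖ² + ½ (n - 1) ∫ Γ` (`trace_identity`), and `tr (T²) = ∑ₖ cₖ² - 2 Γ`.
* Where no `xₖ` is `1/2`, the quadratic form `∑ Vₖ² (1 - 2 xₖ) / xₖ²` is nonnegative on
  `∑ Vₖ = 0`, although one coefficient may be negative. The integrand of the theorem is its dual
  form, hence it is nonnegative (`dualForm_nonneg`) and Young's inequality holds for the pairing of
  `∇f` with `V` (`pairing_le`).

Together, `∫ f L u = -∫ V · ∇f ≤ 2 ∫ G_f + ½ ∫ (L u)²` for Lipschitz `f`, with the integration by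
parts of `integral_by_parts`. By Stone–Weierstrass, `L u` can be taken arbitrarily close to `f`
in `L²` when `f` has mean zero, which gives `∫ f² ≤ 4 ∫ G_f`. Only `u` has to be smooth; the function
`f` itself is never approximated in a Sobolev norm.
-/

namespace SimplexPoincare

open MvPolynomial

variable {n : ℕ}

/-! ### The Jacobi operator on polynomials -/

/-- The Euler derivation `∑ xₖ ∂ₖ` on polynomials. -/
noncomputable def euler (n : ℕ) : Derivation ℝ (MvPolynomial (Fin n) ℝ) (MvPolynomial (Fin n) ℝ) :=
  ∑ k, (X k : MvPolynomial (Fin n) ℝ) • pderiv k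

theorem euler_apply (p : MvPolynomial (Fin n) ℝ) : euler n p = ∑ k, X k * pderiv k p := by
  have h := congrFun (map_sum (Derivation.coeFnAddMonoidHom (R := ℝ)
    (A := MvPolynomial (Fin n) ℝ) (M := MvPolynomial (Fin n) ℝ))
    (fun k => (X k : MvPolynomial (Fin n) ℝ) • pderiv k) Finset.univ) p
  rw [Finset.sum_apply] at h
  exact h

/-- `cᵢ = ∂ᵢ u - ∑ xₖ ∂ₖ u`: the field `A ∇u`, with `A = diag y - y yᵀ`, has `yᵢ cᵢ` as its `i`-th
component. -/
noncomputable def logGrad (u : MvPolynomial (Fin n) ℝ) (i : Fin n) : MvPolynomial (Fin n) ℝ :=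
  pderiv i u - euler n u

/-- The vector field `A ∇u` with `A = diag y - y yᵀ`, that is, `Vᵢ = yᵢ cᵢ`. -/
noncomputable def grad (u : MvPolynomial (Fin n) ℝ) (i : Fin n) : MvPolynomial (Fin n) ℝ :=
  X i * logGrad u i

/-- Divergence of a polynomial vector field. -/
noncomputable def div (V : Fin n → MvPolynomial (Fin n) ℝ) : MvPolynomial (Fin n) ℝ :=
  ∑ i, pderiv i (V i)

/-- The Jacobi (Wright–Fisher) operator `L u = div (A ∇u)` of the simplex. -/
noncomputable def jacobiOp (u : MvPolynomial (Fin n) ℝ) : MvPolynomial (Fin n) ℝ :=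
  div (grad u)

/-- The carré du champ `Γ(u) = ⟨A ∇u, ∇u⟩`. It is also `∑ xₖ cₖ²` over `k ≥ 0`,
with `c₀ = -∑ xₖ ∂ₖ u`. -/
noncomputable def carre (u : MvPolynomial (Fin n) ℝ) : MvPolynomial (Fin n) ℝ :=
  ∑ i, X i * logGrad u i * pderiv i u

theorem pderiv_comm (i j : Fin n) (p : MvPolynomial (Fin n) ℝ) :
    pderiv i (pderiv j p) = pderiv j (pderiv i p) := by
  let D : Fin n → Derivation ℝ (MvPolynomial (Fin n) ℝ) (MvPolynomial (Fin n) ℝ) := pderiv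
  have h : ⁅D i, D j⁆ = 0 := by
    refine MvPolynomial.derivation_ext fun k => ?_
    classical
    simp only [D]
    rw [Derivation.commutator_apply, pderiv_X, pderiv_X, Pi.single_apply, Pi.single_apply]
    split_ifs <;> simp
  have h2 := DFunLike.congr_fun h p
  simpa [Derivation.commutator_apply, sub_eq_zero] using h2

/-- `(div V)²` and `tr ((DV)²)` differ by a divergence. -/
theorem sq_div_sub_trace (V : Fin n → MvPolynomial (Fin n) ℝ) :
    div V ^ 2 - ∑ i, ∑ j, pderiv j (V i) * pderiv i (V j)
      = div (fun i => V i * div V - ∑ j, V j * pderiv j (V i)) := by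
  have h1 : ∑ i, V i * pderiv i (div V) = ∑ i, ∑ j, V j * pderiv i (pderiv j (V i)) := by
    simp only [div, map_sum, Finset.mul_sum]
    rw [Finset.sum_comm]
    refine Finset.sum_congr rfl fun i _ => Finset.sum_congr rfl fun j _ => ?_
    rw [pderiv_comm]
  conv_rhs => rw [div]
  simp only [map_sub, map_sum, pderiv_mul, Finset.sum_sub_distrib, Finset.sum_add_distrib]
  rw [h1, ← Finset.sum_mul]
  have h2 : ∑ i, ∑ j, pderiv i (V j) * pderiv j (V i) = ∑ i, ∑ j, pderiv j (V i) * pderiv i (V j) :=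
    Finset.sum_congr rfl fun i _ => Finset.sum_congr rfl fun j _ => mul_comm _ _
  rw [h2, ← div]
  ring

/-- The component of `A ∇u` in the coordinate `x₀ = 1 - ∑ yᵢ` is `-x₀ e`, so `c₀ = -e`. -/
theorem sum_grad (u : MvPolynomial (Fin n) ℝ) :
    ∑ i, grad u i = (1 - ∑ i, X i) * euler n u := by
  simp only [grad, logGrad, mul_sub, Finset.sum_sub_distrib, ← Finset.sum_mul]
  rw [← euler_apply]; ring

theorem euler_X (i : Fin n) : euler n (X i) = X i := by
  classical
  simp [euler_apply, pderiv_X, Pi.single_apply]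

theorem carre_eq (u : MvPolynomial (Fin n) ℝ) :
    carre u = ∑ i, X i * pderiv i u ^ 2 - euler n u ^ 2 := by
  have : euler n u ^ 2 = ∑ i, X i * pderiv i u * euler n u := by
    rw [← Finset.sum_mul, ← euler_apply, sq]
  rw [this, carre, ← Finset.sum_sub_distrib]
  refine Finset.sum_congr rfl fun i _ => ?_
  rw [logGrad]; ring

/-- With `T` the matrix `δᵢⱼ cᵢ - yᵢ ∂ⱼu`, the left-hand side is `2 tr ((DV) T)`; up to a divergence
it contains no second derivatives of `u`. -/
theorem trace_identity (u : MvPolynomial (Fin n) ℝ) :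
    2 * (∑ i, pderiv i (grad u i) * logGrad u i
        - ∑ i, ∑ j, pderiv j (grad u i) * (X j * pderiv i u))
      = div (fun i => X i * (logGrad u i ^ 2 - carre u))
        + (∑ i, logGrad u i ^ 2 + euler n u ^ 2) + (n - 1) * carre u := by
  have hE : ∀ p : MvPolynomial (Fin n) ℝ, ∑ j, X j * pderiv j p = euler n p :=
    fun p => (euler_apply p).symm
  set e := euler n u with he
  -- the two sides of the Euler derivative of `∑ xᵢ cᵢ = (1 - ∑ xᵢ) e`
  have hS : ∑ i, X i * euler n (logGrad u i) = (1 - ∑ i, X i) * euler n e - e := by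
    have h := congrArg (euler n) (sum_grad u)
    simp only [map_sum, grad, Derivation.leibniz, smul_eq_mul, map_sub, euler_X,
      Derivation.map_one_eq_zero, Finset.sum_add_distrib] at h
    have h2 : ∑ i, logGrad u i * X i = (1 - ∑ i, X i) * e := by
      rw [he, ← sum_grad]; simp only [grad, mul_comm]
    rw [h2] at h
    rw [← he] at h
    linear_combination h
  have hΓ : euler n (carre u) = carre u + 2 * ∑ i, X i * pderiv i u * euler n (logGrad u i)
      + e ^ 2 := by
    have h2 : ∑ i, X i * logGrad u i = (1 - ∑ i, X i) * e := sum_grad u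
    have h3 : euler n (carre u) = carre u + ∑ i, X i * pderiv i u * euler n (logGrad u i)
        + ∑ i, (X i * pderiv i u * euler n (logGrad u i)
          - e * (X i * euler n (logGrad u i)) + X i * logGrad u i * euler n e) := by
      rw [carre, map_sum, ← Finset.sum_add_distrib, ← Finset.sum_add_distrib]
      refine Finset.sum_congr rfl fun i _ => ?_
      have h4 : euler n (pderiv i u) = euler n (logGrad u i) + euler n e := by
        rw [logGrad, map_sub]; ring
      simp only [Derivation.leibniz, smul_eq_mul, euler_X, h4]
      have h5 : logGrad u i = pderiv i u - e := rfl
      linear_combination (X i * euler n (logGrad u i)) * h5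
    rw [h3, Finset.sum_add_distrib, Finset.sum_sub_distrib, ← Finset.mul_sum, hS,
      ← Finset.sum_mul, h2]
    ring
  have hL : ∑ i, pderiv i (grad u i) * logGrad u i
      = ∑ i, logGrad u i ^ 2 + ∑ i, X i * (logGrad u i * pderiv i (logGrad u i)) := by
    rw [← Finset.sum_add_distrib]
    refine Finset.sum_congr rfl fun i _ => ?_
    rw [grad, pderiv_mul, pderiv_X_self]; ring
  have hR : ∑ i, ∑ j, pderiv j (grad u i) * (X j * pderiv i u)
      = carre u + ∑ i, X i * pderiv i u * euler n (logGrad u i) := by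
    rw [carre, ← Finset.sum_add_distrib]
    refine Finset.sum_congr rfl fun i _ => ?_
    have : ∑ j, pderiv j (grad u i) * (X j * pderiv i u) = euler n (grad u i) * pderiv i u := by
      rw [euler_apply, Finset.sum_mul]
      exact Finset.sum_congr rfl fun j _ => by ring
    rw [this, grad, Derivation.leibniz, euler_X, smul_eq_mul, smul_eq_mul]; ring
  have hF : div (fun i => X i * (logGrad u i ^ 2 - carre u))
      = ∑ i, logGrad u i ^ 2 - n * carre u
        + 2 * (∑ i, X i * (logGrad u i * pderiv i (logGrad u i))) - euler n (carre u) := by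
    have h1 : (n : MvPolynomial (Fin n) ℝ) * carre u = ∑ i : Fin n, carre u := by simp
    rw [h1, euler_apply, Finset.mul_sum, ← Finset.sum_sub_distrib, ← Finset.sum_add_distrib,
      ← Finset.sum_sub_distrib, div]
    refine Finset.sum_congr rfl fun i _ => ?_
    rw [pderiv_mul, pderiv_X_self, map_sub, pderiv_pow]
    push_cast; ring
  rw [hL, hR, hF, hΓ]
  ring

/-- A polynomial field `(xᵢ Pᵢ)` is tangent to the facets of the simplex when the sum of its
components is divisible by `x₀ = 1 - ∑ xᵢ`. -/
def TangentPotential (P : Fin n → MvPolynomial (Fin n) ℝ) (P₀ : MvPolynomial (Fin n) ℝ) : Prop :=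
  ∑ i, X i * P i = (1 - ∑ i, X i) * P₀

theorem tangent_logGrad (u : MvPolynomial (Fin n) ℝ) :
    TangentPotential (logGrad u) (euler n u) := sum_grad u

theorem div_two_mul_add (A B : Fin n → MvPolynomial (Fin n) ℝ) :
    div (fun i => 2 * A i + B i) = 2 * div A + div B := by
  have : (2 : MvPolynomial (Fin n) ℝ) = C 2 := (map_ofNat C 2).symm
  simp only [div, map_add, Finset.sum_add_distrib, Finset.mul_sum, this, pderiv_C_mul]

/-- The field of `sq_div_sub_trace` for `V = grad u` has its `i`-th component divisible by `yᵢ`. -/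
theorem X_mul_bochnerPotential (u D : MvPolynomial (Fin n) ℝ) (i : Fin n) :
    X i * (logGrad u i * D - logGrad u i ^ 2 - ∑ j, grad u j * pderiv j (logGrad u i))
      = grad u i * D - ∑ j, grad u j * pderiv j (grad u i) := by
  have : ∑ j, grad u j * pderiv j (grad u i)
      = grad u i * logGrad u i + X i * ∑ j, grad u j * pderiv j (logGrad u i) := by
    have h2 : grad u i * logGrad u i
        = ∑ j, grad u j * (pderiv j (X i) * logGrad u i) := by
      classical
      simp [pderiv_X, Pi.single_apply]
    rw [h2, Finset.mul_sum, ← Finset.sum_add_distrib]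
    refine Finset.sum_congr rfl fun j _ => ?_
    conv_lhs => rw [grad, grad, pderiv_mul]
    rw [grad]; ring
  rw [this]; simp only [grad]; ring

theorem tangent_bochner (u D : MvPolynomial (Fin n) ℝ) :
    TangentPotential
      (fun i => logGrad u i * D - logGrad u i ^ 2 - ∑ j, grad u j * pderiv j (logGrad u i))
      (euler n u * D + euler n u ^ 2 - ∑ j, grad u j * pderiv j (euler n u)) := by
  set e := euler n u with he
  have hsum := sum_grad u
  rw [TangentPotential]
  simp only [X_mul_bochnerPotential]
  rw [Finset.sum_sub_distrib, ← Finset.sum_mul, Finset.sum_comm]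
  simp only [← Finset.mul_sum, ← map_sum]
  rw [hsum, ← he]
  have h3 : ∀ j, pderiv j ((1 - ∑ i, X i) * e) = - e + (1 - ∑ i, X i) * pderiv j e := by
    intro j
    have : pderiv j (∑ i, X i : MvPolynomial (Fin n) ℝ) = 1 := by
      classical
      simp [pderiv_X, Pi.single_apply]
    rw [pderiv_mul, map_sub, this, pderiv_one]; ring
  have h4 : ∑ j, grad u j * pderiv j ((1 - ∑ i, X i) * e)
      = - ((∑ j, grad u j) * e) + (1 - ∑ i, X i) * ∑ j, grad u j * pderiv j e := by
    simp only [h3]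
    rw [Finset.sum_mul, Finset.mul_sum, ← Finset.sum_neg_distrib, ← Finset.sum_add_distrib]
    exact Finset.sum_congr rfl fun j _ => by ring
  rw [h4, hsum]; ring

theorem tangent_sq_logGrad (u : MvPolynomial (Fin n) ℝ) :
    TangentPotential (fun i => logGrad u i ^ 2 - carre u) (carre u - euler n u ^ 2) := by
  have h1 : ∑ i, X i * logGrad u i ^ 2 = carre u - euler n u * ∑ i, grad u i := by
    rw [carre, Finset.mul_sum, ← Finset.sum_sub_distrib]
    refine Finset.sum_congr rfl fun i _ => ?_
    rw [grad, logGrad]; ring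
  simp only [TangentPotential, mul_sub, Finset.sum_sub_distrib, h1, sum_grad, ← Finset.sum_mul]
  ring

theorem TangentPotential.two_mul_add {P Q : Fin n → MvPolynomial (Fin n) ℝ}
    {P₀ Q₀ : MvPolynomial (Fin n) ℝ} (hP : TangentPotential P P₀) (hQ : TangentPotential Q Q₀) :
    TangentPotential (fun i => 2 * P i + Q i) (2 * P₀ + Q₀) := by
  rw [TangentPotential] at *
  simp only [mul_add, Finset.sum_add_distrib, mul_left_comm _ (2 : MvPolynomial (Fin n) ℝ),
    ← Finset.mul_sum, hP, hQ]

/-- `sq_div_sub_trace` and `trace_identity` combined: twice `(L u)²` is, up to the divergence of a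
field tangent to all facets, `2 tr (B²) - 2 tr (B T) + ∑ cₖ² + (n - 1) Γ` with `B = DV`. -/
theorem exists_tangent_two_mul_sq_sub_div (u : MvPolynomial (Fin n) ℝ) :
    ∃ (P : Fin n → MvPolynomial (Fin n) ℝ) (P₀ : MvPolynomial (Fin n) ℝ), TangentPotential P P₀ ∧
      2 * jacobiOp u ^ 2 - div (fun i => X i * P i) =
      2 * ∑ i, ∑ j, pderiv j (grad u i) * pderiv i (grad u j)
        - 2 * (∑ i, pderiv i (grad u i) * logGrad u i
          - ∑ i, ∑ j, pderiv j (grad u i) * (X j * pderiv i u))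
        + (∑ i, logGrad u i ^ 2 + euler n u ^ 2) + (n - 1) * carre u := by
  refine ⟨_, _, (tangent_bochner u (jacobiOp u)).two_mul_add (tangent_sq_logGrad u), ?_⟩
  simp only [mul_add, mul_left_comm _ (2 : MvPolynomial (Fin n) ℝ), X_mul_bochnerPotential]
  have h1 := sq_div_sub_trace (grad u)
  have h2 := trace_identity u
  rw [div_two_mul_add]
  rw [jacobiOp] at *
  rw [← h1]
  linear_combination h2

/-! ### Solving the Jacobi equation in polynomials -/

theorem jacobiOp_add (u v : MvPolynomial (Fin n) ℝ) :
    jacobiOp (u + v) = jacobiOp u + jacobiOp v := by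
  simp only [jacobiOp, div, grad, logGrad, ← Finset.sum_add_distrib]
  refine Finset.sum_congr rfl fun i _ => ?_
  rw [← map_add]
  congr 1
  simp only [map_add]; ring

theorem jacobiOp_smul (a : ℝ) (u : MvPolynomial (Fin n) ℝ) :
    jacobiOp (a • u) = a • jacobiOp u := by
  simp only [jacobiOp, div, grad, logGrad, Finset.smul_sum]
  refine Finset.sum_congr rfl fun i _ => ?_
  rw [← Derivation.map_smul]
  congr 1
  simp only [Derivation.map_smul, smul_sub, mul_sub, mul_smul_comm]

theorem euler_monomial (s : Fin n →₀ ℕ) (a : ℝ) :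
    euler n (monomial s a) = s.degree • monomial s a := by
  simp only [euler_apply, X_mul_pderiv_monomial, ← Finset.sum_smul]
  rw [Finsupp.degree_eq_sum]

/-- On monomials of degree `d`, `L` is `-(n + d) d` plus an operator that lowers the degree. -/
theorem jacobiOp_monomial (s : Fin n →₀ ℕ) (a : ℝ) :
    jacobiOp (monomial s a) = ∑ i, s i • pderiv i (monomial s a)
      - ((n + s.degree) * s.degree) • monomial s a := by
  have h : ∀ i, pderiv i (grad (monomial s a) i) = s i • pderiv i (monomial s a)
      - s.degree • monomial s a - s.degree • s i • monomial s a := by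
    intro i
    rw [grad, logGrad, mul_sub, X_mul_pderiv_monomial, euler_monomial, map_sub, map_nsmul,
      pderiv_mul, pderiv_X_self, map_nsmul]
    simp only [mul_smul_comm, X_mul_pderiv_monomial, one_mul]
    abel
  simp only [jacobiOp, div, h, Finset.sum_sub_distrib]
  rw [← Finset.smul_sum (r := s.degree), ← Finset.smul_sum (r := s.degree), ← Finset.sum_smul,
    ← Finsupp.degree_eq_sum,
    Finset.sum_const, Finset.card_univ, Fintype.card_fin, add_mul, add_smul, mul_smul, mul_smul]
  rw [smul_comm n]
  abel

/-- The polynomials of the form `L u + const`. -/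
noncomputable def jacobiRange (n : ℕ) : Submodule ℝ (MvPolynomial (Fin n) ℝ) :=
  LinearMap.range ({ toFun := jacobiOp, map_add' := jacobiOp_add, map_smul' := jacobiOp_smul } :
    MvPolynomial (Fin n) ℝ →ₗ[ℝ] MvPolynomial (Fin n) ℝ) ⊔ Submodule.span ℝ {1}

theorem monomial_mem_jacobiRange (d : ℕ) : ∀ (s : Fin n →₀ ℕ) (a : ℝ), s.degree = d →
    monomial s a ∈ jacobiRange n := by
  induction d with
  | zero =>
    intro s a hs
    rw [Finsupp.degree_eq_zero_iff] at hs
    refine Submodule.mem_sup_right (Submodule.mem_span_singleton.2 ⟨a, ?_⟩)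
    rw [hs, smul_eq_C_mul, mul_one]; rfl
  | succ d ih =>
    intro s a hs
    have h1 : ∀ i, s i • pderiv i (monomial s a) ∈ jacobiRange n := by
      intro i
      rcases Nat.eq_zero_or_pos (s i) with h | h
      · rw [h, zero_smul]; exact zero_mem _
      · refine nsmul_mem ?_ _
        rw [pderiv_monomial]
        refine ih _ _ ?_
        have h2 : s - Finsupp.single i 1 + Finsupp.single i 1 = s :=
          tsub_add_cancel_of_le (by simpa [Nat.one_le_iff_ne_zero] using h.ne')
        have h3 := congrArg Finsupp.degree h2
        rw [map_add, Finsupp.degree_single] at h3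
        omega
    have h2 : ((n + s.degree) * s.degree) • monomial s a ∈ jacobiRange n := by
      have h3 := jacobiOp_monomial s a
      rw [eq_sub_iff_add_eq, ← eq_sub_iff_add_eq'] at h3
      rw [h3]
      exact sub_mem (sum_mem fun i _ => h1 i)
        (Submodule.mem_sup_left (LinearMap.mem_range.2 ⟨monomial s a, rfl⟩))
    rw [← Nat.cast_smul_eq_nsmul ℝ] at h2
    refine (Submodule.smul_mem_iff _ ?_).1 h2
    rw [hs]; positivity

theorem exists_jacobiOp_eq (p : MvPolynomial (Fin n) ℝ) :
    ∃ (u : MvPolynomial (Fin n) ℝ) (a : ℝ), jacobiOp u = p + C a := by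
  have hp : p ∈ jacobiRange n := by
    induction p using MvPolynomial.induction_on' with
    | monomial s a => exact monomial_mem_jacobiRange _ s a rfl
    | add p q hp hq => exact add_mem hp hq
  obtain ⟨_, ⟨u, rfl⟩, z, hz, h⟩ := Submodule.mem_sup.1 hp
  obtain ⟨a, rfl⟩ := Submodule.mem_span_singleton.1 hz
  refine ⟨u, -a, ?_⟩
  rw [← h, smul_eq_C_mul]
  simp

/-! ### The pointwise Bochner inequality -/

/-- Cauchy–Schwarz with the weights `yᵢ`, whose sum is less than one. -/
theorem sq_sum_mul_le {y : Fin n → ℝ} (hy : y ∈ cornerSimplex n) (v : Fin n → ℝ) :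
    (∑ i, y i * v i) ^ 2 ≤ ∑ i, y i * v i ^ 2 := by
  have h := Finset.sum_mul_sq_le_sq_mul_sq Finset.univ (fun i => √(y i))
    (fun i => √(y i) * v i)
  have h1 : ∀ i, √(y i) * (√(y i) * v i) = y i * v i := fun i => by
    rw [← mul_assoc, Real.mul_self_sqrt (hy.1 i).le]
  simp only [h1, mul_pow, Real.sq_sqrt (hy.1 _).le] at h
  have h2 : 0 ≤ ∑ i, y i * v i ^ 2 :=
    Finset.sum_nonneg fun i _ => mul_nonneg (hy.1 i).le (sq_nonneg _)
  nlinarith [hy.2]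

open Matrix in
open scoped MatrixOrder Matrix.Norms.L2Operator in
theorem trace_mul_self_nonneg {A Y : Matrix (Fin n) (Fin n) ℝ} (hA : A.PosSemidef)
    (hY : Yᵀ = Y) : 0 ≤ ((A * Y) * (A * Y)).trace := by
  obtain ⟨R, rfl⟩ := CStarAlgebra.nonneg_iff_eq_star_mul_self.mp hA.nonneg
  rw [Matrix.star_eq_conjTranspose]
  have h : ((Rᴴ * R * Y) * (Rᴴ * R * Y)).trace = ((R * Y * Rᴴ)ᴴ * (R * Y * Rᴴ)).trace := by
    rw [Matrix.conjTranspose_mul, Matrix.conjTranspose_mul, Matrix.conjTranspose_conjTranspose,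
      Matrix.conjTranspose_eq_transpose_of_trivial Y, hY]
    rw [Matrix.trace_mul_comm (R * (Y * Rᴴ))]
    simp only [Matrix.mul_assoc]
    rw [Matrix.trace_mul_comm]
    simp only [Matrix.mul_assoc]
  rw [h]
  exact (Matrix.posSemidef_conjTranspose_mul_self _).trace_nonneg

open Matrix in
theorem posSemidef_covariance {y : Fin n → ℝ} (hy : y ∈ cornerSimplex n) :
    (Matrix.diagonal y - Matrix.vecMulVec y y).PosSemidef := by
  refine Matrix.PosSemidef.of_dotProduct_mulVec_nonneg ?_ fun v => ?_
  · ext i j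
    simp [Matrix.diagonal_apply, Matrix.vecMulVec_apply, mul_comm, eq_comm]
    grind
  · have h := sq_sum_mul_le hy v
    have h2 : star v ⬝ᵥ (Matrix.diagonal y - Matrix.vecMulVec y y) *ᵥ v
        = ∑ i, y i * v i ^ 2 - (∑ i, y i * v i) ^ 2 := by
      rw [Matrix.sub_mulVec, dotProduct_sub, Matrix.vecMulVec_mulVec, sq (∑ i, y i * v i),
        Finset.sum_mul]
      simp only [dotProduct, Matrix.mulVec_diagonal]
      congr 1
      · exact Finset.sum_congr rfl fun i _ => by simp; ring
      · exact Finset.sum_congr rfl fun i _ => by simp; ring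
    rw [h2]; linarith

open Matrix in
/-- `tr (B²) - tr (B T) + tr (T²) / 4 = tr ((B - T/2)²) ≥ 0`, where `g`, `U` are the gradient and the
Hessian of a function at `y`, `B` is the Jacobian matrix of `A ∇u`, and `Tᵢⱼ = δᵢⱼ cᵢ - yᵢ gⱼ`. The
point is that `B - T/2 = A Y` with `Y = U + Z/2` symmetric. -/
theorem trace_hessian_nonneg {y : Fin n → ℝ} (hy : y ∈ cornerSimplex n) (g : Fin n → ℝ)
    (U : Matrix (Fin n) (Fin n) ℝ) (hU : Uᵀ = U) (c : Fin n → ℝ)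
    (hc : ∀ i, c i = g i - ∑ k, y k * g k) (B : Matrix (Fin n) (Fin n) ℝ)
    (hB : ∀ i j, B i j = (if i = j then c i else 0) + y i * (U i j - g j - ∑ k, y k * U k j)) :
    0 ≤ ∑ i, ∑ j, B i j * B j i - (∑ i, B i i * c i - ∑ i, ∑ j, B i j * (y j * g i))
      + (∑ i, c i ^ 2 + (∑ k, y k * g k) ^ 2 - 2 * ∑ i, y i * c i * g i) / 4 := by
  set e := ∑ k, y k * g k with he
  set T : Matrix (Fin n) (Fin n) ℝ := Matrix.of fun i j => (if i = j then c i else 0) - y i * g j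
    with hT
  -- `T = A Z` with `Zᵢⱼ = δᵢⱼ cᵢ / yᵢ + c₀ / x₀`; `z` is the constant `c₀ / x₀`.
  set z : ℝ := -e / (1 - ∑ i, y i) with hz
  set Y : Matrix (Fin n) (Fin n) ℝ :=
    Matrix.of fun i j => U i j + ((if i = j then c i / y i else 0) + z) / 2 with hYdef
  have hx0 : 1 - ∑ i, y i ≠ 0 := by linarith [hy.2]
  have hY : Yᵀ = Y := by
    ext i j
    have := congrFun (congrFun hU i) j
    simp only [Matrix.transpose_apply] at this
    simp only [hYdef, Matrix.transpose_apply, Matrix.of_apply, this]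
    grind
  have hAY : (Matrix.diagonal y - Matrix.vecMulVec y y) * Y = B - (1 / 2 : ℝ) • T := by
    ext i j
    have h1 : ∑ k, y k * Y k j = ∑ k, y k * U k j + (c j + (∑ k, y k) * z) / 2 := by
      simp only [hYdef, Matrix.of_apply, mul_add, add_div, mul_div_assoc', Finset.sum_add_distrib]
      rw [← Finset.sum_div, ← Finset.sum_div, Finset.sum_mul]
      simp [mul_div_cancel₀, (hy.1 j).ne']
    rw [Matrix.sub_mul, Matrix.sub_apply, Matrix.diagonal_mul, Matrix.vecMulVec_mul]
    simp only [Matrix.vecMulVec_apply, Matrix.sub_apply, Matrix.smul_apply, smul_eq_mul]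
    have h2 : (y ᵥ* Y) j = ∑ k, y k * Y k j := rfl
    rw [h2, h1, hB]
    have h3 : z * (1 - ∑ i, y i) = -e := by rw [hz]; field_simp
    simp only [hYdef, hT, Matrix.of_apply]
    have hci := hc j
    have hyi := (hy.1 i).ne'
    by_cases hij : i = j
    · subst hij
      simp only [if_true]
      field_simp
      linear_combination y i * h3 - y i * hci
    · simp only [hij, if_false]
      linear_combination y i / 2 * h3 - y i / 2 * hci
  have h := trace_mul_self_nonneg (posSemidef_covariance hy) hY
  rw [hAY] at h
  have hexp : ((B - (1 / 2 : ℝ) • T) * (B - (1 / 2 : ℝ) • T)).trace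
      = (B * B).trace - (B * T).trace + (T * T).trace / 4 := by
    simp only [Matrix.sub_mul, Matrix.mul_sub, Matrix.trace_sub, Matrix.smul_mul, Matrix.mul_smul,
      Matrix.trace_smul, smul_eq_mul, Matrix.trace_mul_comm T B]
    ring
  rw [hexp] at h
  have hBB : (B * B).trace = ∑ i, ∑ j, B i j * B j i := rfl
  have hBT : (B * T).trace = ∑ i, B i i * c i - ∑ i, ∑ j, B i j * (y j * g i) := by
    rw [← Finset.sum_sub_distrib]
    refine Finset.sum_congr rfl fun i _ => ?_
    simp [Matrix.mul_apply, hT, mul_sub]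
  have hTT : (T * T).trace = ∑ i, c i ^ 2 + e ^ 2 - 2 * ∑ i, y i * c i * g i := by
    have h1 : ∀ i, (T * T) i i = c i ^ 2 + y i * g i * e - 2 * (y i * c i * g i) := by
      intro i
      have : ∀ j, T i j * T j i = (if i = j then c i * c i - 2 * (y i * c i * g i) else 0)
          + y i * g i * (y j * g j) := by
        intro j
        by_cases hij : i = j
        · subst hij; simp [hT]; ring
        · simp [hT, hij, Ne.symm hij]; ring
      rw [Matrix.mul_apply]
      simp only [this, Finset.sum_add_distrib, ← Finset.mul_sum]
      simp [← he]; ring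
    rw [Matrix.trace]
    simp only [Matrix.diag_apply, h1, Finset.sum_sub_distrib, Finset.sum_add_distrib,
      ← Finset.sum_mul, ← Finset.mul_sum]
    rw [← he]; ring
  rw [hBB, hBT, hTT] at h
  exact h

theorem eval_carre (u : MvPolynomial (Fin n) ℝ) (y : Fin n → ℝ) :
    eval y (carre u) = ∑ i, y i * eval y (logGrad u i) * eval y (pderiv i u) := by
  simp [carre]

theorem eval_euler (u : MvPolynomial (Fin n) ℝ) (y : Fin n → ℝ) :
    eval y (euler n u) = ∑ i, y i * eval y (pderiv i u) := by
  simp [euler_apply]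

theorem eval_carre_nonneg {y : Fin n → ℝ} (hy : y ∈ cornerSimplex n)
    (u : MvPolynomial (Fin n) ℝ) : 0 ≤ eval y (carre u) := by
  have := sq_sum_mul_le hy fun i => eval y (pderiv i u)
  rw [carre_eq]
  simp only [map_sub, map_sum, map_mul, map_pow, eval_X, eval_euler]
  linarith

/-- The pointwise form of the Bochner inequality, up to a divergence that integrates to zero. The
bracket is `∑ cₖ² (1 - 2 xₖ)`, with the sum over `k ≥ 0`. -/
theorem exists_bochner (u : MvPolynomial (Fin n) ℝ) :
    ∃ (P : Fin n → MvPolynomial (Fin n) ℝ) (P₀ : MvPolynomial (Fin n) ℝ), TangentPotential P P₀ ∧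
      ∀ y ∈ cornerSimplex n,
        (∑ i, eval y (logGrad u i) ^ 2 + eval y (euler n u) ^ 2 - 2 * eval y (carre u)) / 2
          + eval y (div fun i => X i * P i) ≤ 2 * eval y (jacobiOp u) ^ 2 := by
  obtain ⟨P, P₀, hP, h⟩ := exists_tangent_two_mul_sq_sub_div u
  refine ⟨P, P₀, hP, fun y hy => ?_⟩
  have h1 := congrArg (eval y) h
  have hB : ∀ i j, eval y (pderiv j (grad u i)) = (if i = j then eval y (logGrad u i) else 0)
      + y i * (eval y (pderiv j (pderiv i u)) - eval y (pderiv j u)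
        - ∑ k, y k * eval y (pderiv j (pderiv k u))) := by
    intro i j
    classical
    have h2 : pderiv j (euler n u) = pderiv j u + ∑ k, X k * pderiv j (pderiv k u) := by
      simp only [euler_apply, map_sum, pderiv_mul, Finset.sum_add_distrib]
      simp [pderiv_X, Pi.single_apply]
    rw [grad, pderiv_mul, pderiv_X, Pi.single_apply]
    conv_lhs => rw [logGrad, map_sub, h2]
    rw [logGrad]
    split_ifs <;> simp only [map_add, map_sub, map_mul, map_sum, map_one, map_zero, eval_X] <;> ring
  have h3 := trace_hessian_nonneg hy (fun i => eval y (pderiv i u))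
    (Matrix.of fun i j => eval y (pderiv j (pderiv i u)))
    (by ext i j; simp only [Matrix.transpose_apply, Matrix.of_apply]; rw [pderiv_comm])
    (fun i => eval y (logGrad u i)) (fun i => by rw [logGrad, map_sub, eval_euler])
    (Matrix.of fun i j => eval y (pderiv j (grad u i)))
    (fun i j => by simp only [Matrix.of_apply]; exact hB i j)
  simp only [Matrix.of_apply] at h3
  rw [← eval_carre, ← eval_euler] at h3
  simp only [map_sub, map_add, map_mul, map_sum, map_pow, map_ofNat, map_natCast, map_one,
    eval_X] at h1
  have h4 := eval_carre_nonneg hy u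
  have h5 : 0 ≤ (n : ℝ) * eval y (carre u) := by positivity
  linarith

/-! ### Integration by parts on the simplex -/

theorem isOpen_cornerSimplex (n : ℕ) : IsOpen (cornerSimplex n) := by
  have : cornerSimplex n = (⋂ i, {y : Fin n → ℝ | 0 < y i}) ∩ {y | ∑ i, y i < 1} := by
    ext y; simp [cornerSimplex]
  rw [this]
  exact (isOpen_iInter_of_finite fun i => isOpen_lt continuous_const (continuous_apply i)).inter
    (isOpen_lt (by fun_prop) continuous_const)

theorem cornerSimplex_subset_Icc (n : ℕ) : cornerSimplex n ⊆ Set.Icc 0 1 := by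
  intro y hy
  refine ⟨fun i => (hy.1 i).le, fun i => ?_⟩
  exact (Finset.single_le_sum (f := y) (fun j _ => (hy.1 j).le) (Finset.mem_univ i)).trans hy.2.le

theorem mem_cornerSimplex_iff {y : Fin n → ℝ} :
    y ∈ cornerSimplex n ↔ ∀ l, 0 < simplexLift n y l := by
  rw [Fin.forall_fin_succ]
  simp [simplexLift, cornerSimplex, and_comm]

theorem integrableOn_cornerSimplex {g : (Fin n → ℝ) → ℝ} (hg : Continuous g) :
    IntegrableOn g (cornerSimplex n) :=
  (hg.continuousOn.integrableOn_compact isCompact_Icc).mono_set (cornerSimplex_subset_Icc n)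

theorem hasFDerivAt_eval (p : MvPolynomial (Fin n) ℝ) (y : Fin n → ℝ) :
    HasFDerivAt (fun y => eval y p)
      (∑ i, eval y (pderiv i p) • ContinuousLinearMap.proj (R := ℝ) (φ := fun _ : Fin n => ℝ) i)
      y := by
  induction p using MvPolynomial.induction_on with
  | C a => simpa using hasFDerivAt_const a y
  | add p q hp hq =>
    simp only [map_add, add_smul, Finset.sum_add_distrib]
    exact hp.add hq
  | mul_X p j hp =>
    have h := hp.mul (hasFDerivAt_apply j y)
    simp only [map_mul, eval_X]
    refine h.congr_fderiv ?_
    classical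
    ext v
    have h1 : ∀ i, eval y (pderiv i (p * X j)) * v i
        = (if i = j then eval y p * v i else 0) + y j * (eval y (pderiv i p) * v i) := by
      intro i
      by_cases hij : i = j
      · subst hij
        rw [pderiv_mul, pderiv_X_self, if_pos rfl, map_add, map_mul, map_mul, eval_X, map_one]
        ring
      · rw [pderiv_mul, pderiv_X_of_ne (Ne.symm hij), if_neg hij, map_add, map_mul, map_mul,
          eval_X, map_zero]
        ring
    simp only [_root_.sum_apply, _root_.add_apply,
      _root_.smul_apply, ContinuousLinearMap.proj_apply, smul_eq_mul, h1,
      Finset.sum_add_distrib, ← Finset.mul_sum]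
    simp

theorem contDiff_eval (p : MvPolynomial (Fin n) ℝ) : ContDiff ℝ 1 fun y => eval y p := by
  induction p using MvPolynomial.induction_on with
  | C a => simpa using contDiff_const
  | add p q hp hq => simpa using hp.add hq
  | mul_X p j hp => simpa using hp.mul (contDiff_apply ℝ ℝ j)

/-- A smooth function vanishing on `(-∞, 1]` and equal to `1` on `[2, ∞)`. -/
noncomputable def step (t : ℝ) : ℝ := Real.smoothTransition (t - 1)

theorem contDiff_step : ContDiff ℝ 1 step :=
  (Real.smoothTransition.contDiff (n := 1)).comp (contDiff_id.sub contDiff_const)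

theorem deriv_step_eq_zero {t : ℝ} (ht : t < 1 ∨ 2 < t) : deriv step t = 0 := by
  rcases ht with ht | ht
  · have : step =ᶠ[nhds t] fun _ => 0 := by
      filter_upwards [Iio_mem_nhds ht] with s hs
      exact Real.smoothTransition.zero_of_nonpos (by simp at hs; linarith)
    rw [this.deriv_eq]; simp
  · have : step =ᶠ[nhds t] fun _ => 1 := by
      filter_upwards [Ioi_mem_nhds ht] with s hs
      exact Real.smoothTransition.one_of_one_le (by simp at hs; linarith)
    rw [this.deriv_eq]; simp

theorem exists_bound_mul_deriv_step : ∃ B, ∀ t, |t * deriv step t| ≤ B := by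
  have hc : Continuous fun t => t * deriv step t :=
    continuous_id.mul (contDiff_step.continuous_deriv le_rfl)
  have hs : HasCompactSupport fun t => t * deriv step t := by
    refine HasCompactSupport.intro (isCompact_Icc (a := (1 : ℝ)) (b := 2)) fun t ht => ?_
    rw [deriv_step_eq_zero, mul_zero]
    rw [Set.mem_Icc, not_and_or, not_le, not_le] at ht
    exact ht
  obtain ⟨B, hB⟩ := hs.exists_bound_of_continuous hc
  exact ⟨B, fun t => by simpa using hB t⟩

/-- The smooth cutoff function `∏ step (k xₗ)`, supported in the open simplex. -/
noncomputable def cutoff (k : ℕ) (y : Fin n → ℝ) : ℝ := ∏ l, step (k * simplexLift n y l)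

theorem hasFDerivAt_simplexLift (l : Fin (n + 1)) (y : Fin n → ℝ) :
    HasFDerivAt (fun y => simplexLift n y l)
      (Fin.cases (-∑ i, ContinuousLinearMap.proj i)
        (fun i => ContinuousLinearMap.proj i) l : (Fin n → ℝ) →L[ℝ] ℝ) y := by
  refine Fin.cases ?_ (fun i => ?_) l
  · simp only [simplexLift, Fin.cons_zero, Fin.cases_zero]
    exact (HasFDerivAt.fun_sum fun i _ => hasFDerivAt_apply i y).const_sub 1
  · simp only [simplexLift, Fin.cons_succ, Fin.cases_succ]
    exact hasFDerivAt_apply i y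

theorem contDiff_simplexLift (l : Fin (n + 1)) : ContDiff ℝ 1 fun y => simplexLift n y l := by
  refine Fin.cases ?_ (fun i => ?_) l
  · simp only [simplexLift, Fin.cons_zero]; fun_prop
  · simp only [simplexLift, Fin.cons_succ]; fun_prop

theorem contDiff_cutoff (k : ℕ) : ContDiff ℝ 1 (cutoff (n := n) k) :=
  contDiff_prod fun l _ => contDiff_step.comp (contDiff_const.mul (contDiff_simplexLift l))

theorem step_nonneg (t : ℝ) : 0 ≤ step t := Real.smoothTransition.nonneg _

theorem step_le_one (t : ℝ) : step t ≤ 1 := Real.smoothTransition.le_one _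

theorem cutoff_nonneg (k : ℕ) (y : Fin n → ℝ) : 0 ≤ cutoff k y :=
  Finset.prod_nonneg fun _ _ => step_nonneg _

theorem cutoff_le_one (k : ℕ) (y : Fin n → ℝ) : cutoff k y ≤ 1 :=
  Finset.prod_le_one (fun _ _ => step_nonneg _) fun _ _ => step_le_one _

theorem cutoff_eq_zero (k : ℕ) {y : Fin n → ℝ} (hy : y ∉ cornerSimplex n) : cutoff k y = 0 := by
  rw [mem_cornerSimplex_iff] at hy
  push Not at hy
  obtain ⟨l, hl⟩ := hy
  refine Finset.prod_eq_zero (Finset.mem_univ l) (Real.smoothTransition.zero_of_nonpos ?_)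
  have : (k : ℝ) * simplexLift n y l ≤ 0 := mul_nonpos_of_nonneg_of_nonpos k.cast_nonneg hl
  linarith

theorem fderiv_cutoff_eq_zero (k : ℕ) {y : Fin n → ℝ} (hy : y ∉ cornerSimplex n) :
    fderiv ℝ (cutoff k) y = 0 :=
  IsLocalMin.fderiv_eq_zero (Filter.Eventually.of_forall fun z => by
    rw [cutoff_eq_zero k hy]; exact cutoff_nonneg k z)

theorem hasCompactSupport_cutoff (k : ℕ) : HasCompactSupport (cutoff (n := n) k) :=
  HasCompactSupport.intro (isCompact_Icc (a := (0 : Fin n → ℝ)) (b := 1)) fun _ hy =>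
    cutoff_eq_zero k fun h => hy (cornerSimplex_subset_Icc n h)

/-- The derivative of the cutoff along a tangent field stays bounded as `k → ∞`: the factor `k` is
always accompanied by `xₗ`, since the field multiplies the `l`-th barycentric coordinate. -/
theorem fderiv_cutoff_apply (k : ℕ) {P : Fin n → MvPolynomial (Fin n) ℝ}
    {P₀ : MvPolynomial (Fin n) ℝ} (hP : TangentPotential P P₀) (y : Fin n → ℝ) :
    fderiv ℝ (cutoff k) y (fun i => y i * eval y (P i))
      = ∑ l, (∏ m ∈ Finset.univ.erase l, step (k * simplexLift n y m)) *
        (k * simplexLift n y l * deriv step (k * simplexLift n y l)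
          * (Fin.cons (- eval y P₀) (fun i => eval y (P i)) : Fin (n + 1) → ℝ) l) := by
  have h := HasFDerivAt.finsetProd (u := Finset.univ) (x := y)
    (g := fun l (y : Fin n → ℝ) => step (k * simplexLift n y l)) (fun l _ =>
      ((contDiff_step.differentiable one_ne_zero _).hasDerivAt.comp_hasFDerivAt y
        ((hasFDerivAt_simplexLift l y).const_mul (k : ℝ))))
  have h2 : cutoff k = fun y : Fin n → ℝ => ∏ l, step (k * simplexLift n y l) := rfl
  rw [h2, h.fderiv, _root_.sum_apply]
  refine Finset.sum_congr rfl fun l _ => ?_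
  simp only [_root_.smul_apply, smul_eq_mul]
  congr 1
  refine Fin.cases ?_ (fun i => ?_) l
  · have hP' := congrArg (eval y) hP
    simp only [map_sum, map_mul, map_sub, map_one, eval_X] at hP'
    simp [simplexLift, hP']; ring
  · simp [simplexLift]; ring

/-- Integration by parts against a field cut off away from the facets. -/
theorem integral_cutoff {C : NNReal} {f : (Fin n → ℝ) → ℝ} (hf : LipschitzWith C f)
    (P : Fin n → MvPolynomial (Fin n) ℝ) (k : ℕ) :
    ∫ y, (∑ i, lineDeriv ℝ f y (Pi.single i 1) * (y i * eval y (P i))) * cutoff k y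
      = -∫ y, f y * (eval y (div fun i => X i * P i) * cutoff k y
          + fderiv ℝ (cutoff k) y (fun i => y i * eval y (P i))) := by
  classical
  set g : Fin n → (Fin n → ℝ) → ℝ := fun i y => eval y (X i * P i) * cutoff k y with hg
  have hgC : ∀ i, ContDiff ℝ 1 (g i) := fun i => (contDiff_eval _).mul (contDiff_cutoff k)
  have hgS : ∀ i, HasCompactSupport (g i) := fun i => (hasCompactSupport_cutoff k).mul_left
  have hgI : ∀ i, Integrable (g i) := fun i =>
    (hgC i).continuous.integrable_of_hasCompactSupport (hgS i)
  have hd : ∀ i y, lineDeriv ℝ (g i) y (-Pi.single i 1)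
      = -(eval y (pderiv i (X i * P i)) * cutoff k y
        + eval y (X i * P i) * fderiv ℝ (cutoff k) y (Pi.single i 1)) := by
    intro i y
    rw [lineDeriv_neg]
    have h : HasFDerivAt (g i) _ y := (hasFDerivAt_eval (X i * P i) y).mul
      ((contDiff_cutoff k).differentiable one_ne_zero y).hasFDerivAt
    rw [(h.hasLineDerivAt _).lineDeriv]
    simp [Pi.single_apply, -map_mul, -Derivation.leibniz]
    ring
  have hibp : ∀ i, ∫ y, lineDeriv ℝ f y (Pi.single i 1) * g i y
      = ∫ y, lineDeriv ℝ (g i) y (-Pi.single i 1) * f y := by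
    intro i
    obtain ⟨D, hD⟩ := (hgC i).lipschitzWith_of_hasCompactSupport (hgS i) one_ne_zero
    exact hf.integral_lineDeriv_mul_eq hD (hgS i) _
  have hL : ∀ i, Integrable fun y => lineDeriv ℝ f y (Pi.single i 1) * g i y := by
    intro i
    refine (hgI i).bdd_mul (c := C * ‖(Pi.single i 1 : Fin n → ℝ)‖)
      (measurable_lineDeriv hf.continuous).aestronglyMeasurable
      (Filter.Eventually.of_forall fun y => norm_lineDeriv_le_of_lipschitz ℝ hf)
  have hR : ∀ i, Integrable fun y => lineDeriv ℝ (g i) y (-Pi.single i 1) * f y := by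
    intro i
    refine Continuous.integrable_of_hasCompactSupport ?_ ?_
    · simp only [hd]
      have h1 := (contDiff_cutoff (n := n) k).continuous_fderiv one_ne_zero
      have h2 := (contDiff_cutoff (n := n) k).continuous
      have h3 := continuous_eval (pderiv i (X i * P i))
      have h4 := continuous_eval (X i * P i)
      exact (((h3.mul h2).add (h4.mul (h1.clm_apply continuous_const))).neg).mul hf.continuous
    · refine HasCompactSupport.intro (isCompact_Icc (a := (0 : Fin n → ℝ)) (b := 1))
        fun y hy => ?_
      have hy' : y ∉ cornerSimplex n := fun h => hy (cornerSimplex_subset_Icc n h)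
      rw [hd, cutoff_eq_zero k hy', fderiv_cutoff_eq_zero k hy']
      simp
  have h1 : ∫ y, (∑ i, lineDeriv ℝ f y (Pi.single i 1) * (y i * eval y (P i))) * cutoff k y
      = ∑ i, ∫ y, lineDeriv ℝ f y (Pi.single i 1) * g i y := by
    rw [← integral_finsetSum _ fun i _ => hL i]
    congr 1; ext y
    rw [Finset.sum_mul]
    exact Finset.sum_congr rfl fun i _ => by simp [hg]; ring
  rw [h1, Finset.sum_congr rfl fun i _ => hibp i, ← integral_finsetSum _ fun i _ => hR i,
    ← integral_neg]
  congr 1; ext y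
  have h2 : (fun i => y i * eval y (P i))
      = ∑ i, (y i * eval y (P i)) • (Pi.single i 1 : Fin n → ℝ) := by
    ext j; simp [Finset.sum_apply, Pi.single_apply]
  rw [h2, map_sum]
  simp only [hd, map_smul, smul_eq_mul, div, map_sum]
  rw [Finset.sum_mul, ← Finset.sum_add_distrib, Finset.mul_sum, ← Finset.sum_neg_distrib]
  refine Finset.sum_congr rfl fun i _ => ?_
  rw [map_mul (eval y) (X i), eval_X]; ring

theorem eventually_two_lt {y : Fin n → ℝ} (hy : y ∈ cornerSimplex n) :
    ∀ᶠ k : ℕ in Filter.atTop, ∀ l, 2 < (k : ℝ) * simplexLift n y l := by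
  rw [Filter.eventually_all]
  intro l
  exact (tendsto_natCast_atTop_atTop.atTop_mul_const
    (mem_cornerSimplex_iff.1 hy l)).eventually_gt_atTop 2

/-- Integration by parts for a Lipschitz function and a polynomial field tangent to the facets; there
is no boundary term. -/
theorem integral_by_parts {C : NNReal} {f : (Fin n → ℝ) → ℝ} (hf : LipschitzWith C f)
    {P : Fin n → MvPolynomial (Fin n) ℝ} {P₀ : MvPolynomial (Fin n) ℝ}
    (hP : TangentPotential P P₀) :
    ∫ y in cornerSimplex n, ∑ i, lineDeriv ℝ f y (Pi.single i 1) * (y i * eval y (P i))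
      = -∫ y in cornerSimplex n, f y * eval y (div fun i => X i * P i) := by
  obtain ⟨B, hB⟩ := exists_bound_mul_deriv_step
  have hS := (isOpen_cornerSimplex n).measurableSet
  have hχ := fun k => (contDiff_cutoff (n := n) k).continuous
  have hχ' := fun k => (contDiff_cutoff (n := n) k).continuous_fderiv one_ne_zero
  have hW : Continuous fun (y : Fin n → ℝ) i => y i * eval y (P i) :=
    continuous_pi fun i => (continuous_apply i).mul (continuous_eval (P i))
  set L : (Fin n → ℝ) → ℝ := fun y => ∑ i, lineDeriv ℝ f y (Pi.single i 1) * (y i * eval y (P i))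
    with hL
  have hLi : IntegrableOn L (cornerSimplex n) := by
    refine integrable_finsetSum _ fun i _ => ?_
    refine (integrableOn_cornerSimplex ((continuous_apply i).comp hW)).bdd_mul
      (c := C * ‖(Pi.single i 1 : Fin n → ℝ)‖)
      (measurable_lineDeriv hf.continuous).aestronglyMeasurable
      (Filter.Eventually.of_forall fun y => norm_lineDeriv_le_of_lipschitz ℝ hf)
  set Q : Fin (n + 1) → (Fin n → ℝ) → ℝ := fun l y =>
    (Fin.cons (- eval y P₀) (fun i => eval y (P i)) : Fin (n + 1) → ℝ) l with hQ
  have hQc : ∀ l, Continuous (Q l) := by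
    intro l
    refine Fin.cases ?_ (fun i => ?_) l
    · exact (continuous_eval P₀).neg
    · exact continuous_eval (P i)
  set E : (Fin n → ℝ) → ℝ := fun y => eval y (div fun i => X i * P i) with hE
  have hEc : Continuous E := continuous_eval _
  have hl : Filter.Tendsto (fun k : ℕ => ∫ y in cornerSimplex n, L y * cutoff k y) Filter.atTop
      (nhds (∫ y in cornerSimplex n, L y)) := by
    refine tendsto_integral_of_dominated_convergence (fun y => ‖L y‖)
      (fun k => hLi.aestronglyMeasurable.mul (hχ k).aestronglyMeasurable) hLi.norm
      (fun k => Filter.Eventually.of_forall fun y => ?_) ?_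
    · rw [norm_mul, Real.norm_of_nonneg (cutoff_nonneg k y)]
      exact mul_le_of_le_one_right (norm_nonneg _) (cutoff_le_one k y)
    · filter_upwards [ae_restrict_mem hS] with y hy
      refine tendsto_const_nhds.congr' ?_
      filter_upwards [eventually_two_lt hy] with k hk
      rw [cutoff, Finset.prod_eq_one, mul_one]
      exact fun l _ => Real.smoothTransition.one_of_one_le (by linarith [hk l])
  have hr : Filter.Tendsto (fun k : ℕ => ∫ y in cornerSimplex n, f y * (E y * cutoff k y
        + fderiv ℝ (cutoff k) y (fun i => y i * eval y (P i)))) Filter.atTop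
      (nhds (∫ y in cornerSimplex n, f y * E y)) := by
    refine tendsto_integral_of_dominated_convergence
      (fun y => |f y| * (|E y| + ∑ l, B * |Q l y|))
      (fun k => (hf.continuous.mul ((hEc.mul (hχ k)).add
        ((hχ' k).clm_apply hW))).aestronglyMeasurable)
      (integrableOn_cornerSimplex (hf.continuous.abs.mul (hEc.abs.add
        (continuous_finsetSum _ fun l _ => continuous_const.mul (hQc l).abs))))
      (fun k => Filter.Eventually.of_forall fun y => ?_) ?_
    · rw [norm_mul, Real.norm_eq_abs, Real.norm_eq_abs]
      refine mul_le_mul_of_nonneg_left ((abs_add_le _ _).trans (add_le_add ?_ ?_)) (abs_nonneg _)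
      · rw [abs_mul, abs_of_nonneg (cutoff_nonneg k y)]
        exact mul_le_of_le_one_right (abs_nonneg _) (cutoff_le_one k y)
      · rw [fderiv_cutoff_apply k hP]
        refine (Finset.abs_sum_le_sum_abs _ _).trans (Finset.sum_le_sum fun l _ => ?_)
        rw [abs_mul, abs_mul, abs_of_nonneg (Finset.prod_nonneg fun _ _ => step_nonneg _)]
        refine (mul_le_of_le_one_left (by positivity)
          (Finset.prod_le_one (fun _ _ => step_nonneg _) fun _ _ => step_le_one _)).trans ?_
        exact mul_le_mul_of_nonneg_right (hB _) (abs_nonneg _)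
    · filter_upwards [ae_restrict_mem hS] with y hy
      refine tendsto_const_nhds.congr' ?_
      filter_upwards [eventually_two_lt hy] with k hk
      rw [fderiv_cutoff_apply k hP, cutoff, Finset.prod_eq_one, mul_one, Finset.sum_eq_zero,
        add_zero]
      · intro l _
        rw [deriv_step_eq_zero (Or.inr (hk l))]; ring
      · exact fun l _ => Real.smoothTransition.one_of_one_le (by linarith [hk l])
  refine tendsto_nhds_unique hl ((hr.neg).congr fun k => ?_)
  rw [setIntegral_eq_integral_of_forall_compl_eq_zero,
    setIntegral_eq_integral_of_forall_compl_eq_zero, integral_cutoff hf P k]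
  · intro y hy
    rw [cutoff_eq_zero k hy, mul_zero]
  · intro y hy
    rw [cutoff_eq_zero k hy, fderiv_cutoff_eq_zero k hy]; simp

theorem integral_div_eq_zero {P : Fin n → MvPolynomial (Fin n) ℝ} {P₀ : MvPolynomial (Fin n) ℝ}
    (hP : TangentPotential P P₀) :
    ∫ y in cornerSimplex n, eval y (div fun i => X i * P i) = 0 := by
  have h := integral_by_parts (LipschitzWith.const (α := Fin n → ℝ) (1 : ℝ)) hP
  simpa [lineDeriv, neg_eq_zero, eq_comm] using h

/-- The Bochner inequality `∫ ∑ cₖ² (1 - 2 xₖ) ≤ 4 ∫ (L u)²`. -/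
theorem integral_bochner (u : MvPolynomial (Fin n) ℝ) :
    ∫ y in cornerSimplex n, (∑ i, eval y (logGrad u i) ^ 2 + eval y (euler n u) ^ 2
        - 2 * eval y (carre u)) ≤ 4 * ∫ y in cornerSimplex n, eval y (jacobiOp u) ^ 2 := by
  obtain ⟨P, P₀, hP, h⟩ := exists_bochner u
  have hc1 : Continuous fun y => ∑ i, eval y (logGrad u i) ^ 2 + eval y (euler n u) ^ 2
        - 2 * eval y (carre u) :=
    ((continuous_finsetSum _ fun i _ => (continuous_eval _).pow 2).add
      ((continuous_eval _).pow 2)).sub (continuous_const.mul (continuous_eval _))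
  have hc2 : Continuous fun y => eval y (div fun i => X i * P i) := continuous_eval _
  have hc3 : Continuous fun y => eval y (jacobiOp u) ^ 2 := (continuous_eval _).pow 2
  have h1 := setIntegral_mono_on
    (f := fun y => (∑ i, eval y (logGrad u i) ^ 2 + eval y (euler n u) ^ 2
        - 2 * eval y (carre u)) / 2 + eval y (div fun i => X i * P i))
    (g := fun y => 2 * eval y (jacobiOp u) ^ 2)
    (integrableOn_cornerSimplex ((hc1.div_const 2).add hc2))
    (integrableOn_cornerSimplex (continuous_const.mul hc3)) (isOpen_cornerSimplex n).measurableSet h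
  rw [integral_add (integrableOn_cornerSimplex (hc1.div_const 2)) (integrableOn_cornerSimplex hc2),
    integral_div_eq_zero hP, integral_div, integral_const_mul] at h1
  linarith

/-! ### The dual quadratic form -/

/-- Lagrange's identity. -/
theorem sum_lt_prod_eq {m : ℕ} (w a : Fin m → ℝ) :
    ∑ p : Fin m × Fin m with p.1 < p.2, w p.1 * w p.2 * (a p.1 - a p.2) ^ 2
      = (∑ k, w k) * (∑ k, w k * a k ^ 2) - (∑ k, w k * a k) ^ 2 := by
  set F : Fin m × Fin m → ℝ := fun p => w p.1 * w p.2 * (a p.1 - a p.2) ^ 2 with hF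
  have h1 : ∑ p : Fin m × Fin m, F p = 2 * ∑ p : Fin m × Fin m with p.1 < p.2, F p := by
    have h2 : ∑ p : Fin m × Fin m with p.2 < p.1, F p
        = ∑ p : Fin m × Fin m with p.1 < p.2, F p := by
      rw [Finset.sum_filter, Finset.sum_filter, ← (Equiv.prodComm _ _).sum_comp]
      refine Finset.sum_congr rfl fun p _ => ?_
      simp only [Equiv.prodComm_apply, Prod.fst_swap, Prod.snd_swap, hF]
      split_ifs <;> ring
    rw [two_mul]
    nth_rw 2 [← h2]
    rw [Finset.sum_filter, Finset.sum_filter, ← Finset.sum_add_distrib]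
    refine Finset.sum_congr rfl fun p _ => ?_
    rcases lt_trichotomy p.1 p.2 with h | h | h
    · simp [h, h.not_gt]
    · simp [h, hF]
    · simp [h, h.not_gt]
  have h3 : ∑ p : Fin m × Fin m, F p
      = 2 * ((∑ k, w k) * (∑ k, w k * a k ^ 2) - (∑ k, w k * a k) ^ 2) := by
    have h4 : ∀ i j, F (i, j) = (w i * a i ^ 2) * w j + w i * (w j * a j ^ 2)
        - 2 * ((w i * a i) * (w j * a j)) := fun i j => by simp only [hF]; ring
    rw [Fintype.sum_prod_type]
    simp only [h4, Finset.sum_sub_distrib, Finset.sum_add_distrib, ← Finset.mul_sum,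
      ← Finset.sum_mul]
    ring
  linarith

/-- The weight `t² / (1 - 2t)`. -/
noncomputable def weight (t : ℝ) : ℝ := t ^ 2 / (1 - 2 * t)

theorem weight_pos {t : ℝ} (h0 : 0 < t) (h : t < 1 / 2) : 0 < weight t := by
  have : 0 < 1 - 2 * t := by linarith
  unfold weight; positivity

theorem lt_half_of_mem_erase {m : ℕ} {x : Fin m → ℝ} (hx : ∀ k, 0 < x k) (hs : ∑ k, x k = 1)
    {k : Fin m} (hk : 1 / 2 < x k) {j : Fin m} (hj : j ∈ Finset.univ.erase k) : x j < 1 / 2 := by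
  have h1 := Finset.add_sum_erase Finset.univ x (Finset.mem_univ k)
  have h2 := Finset.single_le_sum (f := x) (fun i _ => (hx i).le) hj
  linarith

/-- If `xₖ > 1/2`, its negative weight dominates all the others, because `t ↦ t² / (1 - 2t)` is
superadditive on `[0, 1/2)` and the other coordinates add up to `1 - xₖ < xₖ`. -/
theorem sum_weight_erase_lt {m : ℕ} {x : Fin m → ℝ} (hx : ∀ k, 0 < x k) (hs : ∑ k, x k = 1)
    {k : Fin m} (hk : 1 / 2 < x k) :
    ∑ j ∈ Finset.univ.erase k, weight (x j) < -weight (x k) := by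
  have h1 := Finset.add_sum_erase Finset.univ x (Finset.mem_univ k)
  set s := ∑ j ∈ Finset.univ.erase k, x j with hsdef
  have hs1 : s = 1 - x k := by linarith
  have hpos : 0 < 2 * x k - 1 := by linarith
  have h2 : ∀ j ∈ Finset.univ.erase k, weight (x j) ≤ x j * (s / (2 * x k - 1)) := by
    intro j hj
    have h3 : x j ≤ s := Finset.single_le_sum (f := x) (fun i _ => (hx i).le) hj
    have h4 : 0 < 1 - 2 * x j := by linarith
    rw [weight, sq, mul_div_assoc]
    refine mul_le_mul_of_nonneg_left ?_ (hx j).le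
    exact div_le_div₀ ((hx j).le.trans h3) h3 hpos (by linarith)
  refine (Finset.sum_le_sum h2).trans_lt ?_
  rw [← Finset.sum_mul, ← hsdef, weight, ← div_neg, neg_sub, ← mul_div_assoc]
  refine div_lt_div_of_pos_right ?_ hpos
  have : 0 < x k := hx k
  rw [hs1]; nlinarith

theorem sum_weight_ne_zero {m : ℕ} [NeZero m] {x : Fin m → ℝ} (hx : ∀ k, 0 < x k)
    (hs : ∑ k, x k = 1) (hne : ∀ k, x k ≠ 1 / 2) : ∑ k, weight (x k) ≠ 0 := by
  by_cases h : ∀ k, x k < 1 / 2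
  · exact (Finset.sum_pos (fun k _ => weight_pos (hx k) (h k)) Finset.univ_nonempty).ne'
  · push Not at h
    obtain ⟨k, hk⟩ := h
    have h1 := sum_weight_erase_lt hx hs (lt_of_le_of_ne hk (hne k).symm)
    rw [← Finset.add_sum_erase Finset.univ _ (Finset.mem_univ k)]
    linarith

/-- If one weight is negative, the form `∑ wₖ qₖ²` has signature `(m - 1, 1)` and is negative on the
constants, so it is nonnegative on their orthogonal complement. -/
theorem sum_weight_mul_sq_nonneg {m : ℕ} {x : Fin m → ℝ} (hx : ∀ k, 0 < x k)
    (hs : ∑ k, x k = 1) (hne : ∀ k, x k ≠ 1 / 2) {q : Fin m → ℝ}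
    (hq : ∑ k, weight (x k) * q k = 0) : 0 ≤ ∑ k, weight (x k) * q k ^ 2 := by
  by_cases h : ∀ k, x k < 1 / 2
  · exact Finset.sum_nonneg fun k _ => mul_nonneg (weight_pos (hx k) (h k)).le (sq_nonneg _)
  · push Not at h
    obtain ⟨k, hk⟩ := h
    have hk' := lt_of_le_of_ne hk (hne k).symm
    have h1 := sum_weight_erase_lt hx hs hk'
    rw [← Finset.add_sum_erase Finset.univ _ (Finset.mem_univ k)] at hq ⊢
    have hw : ∀ j ∈ Finset.univ.erase k, 0 < weight (x j) := fun j hj =>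
      weight_pos (hx j) (lt_half_of_mem_erase hx hs hk' hj)
    have hcs := Finset.sum_sq_le_sum_mul_sum_of_sq_le_mul (Finset.univ.erase k)
      (r := fun j => weight (x j) * q j) (f := fun j => weight (x j))
      (g := fun j => weight (x j) * q j ^ 2) (fun j hj => (hw j hj).le)
      (fun j hj => mul_nonneg (hw j hj).le (sq_nonneg _)) (fun j _ => le_of_eq (by ring))
    set A := ∑ j ∈ Finset.univ.erase k, weight (x j) * q j ^ 2
    have hA : 0 ≤ A := Finset.sum_nonneg fun j hj => mul_nonneg (hw j hj).le (sq_nonneg _)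
    have hS : 0 ≤ ∑ j ∈ Finset.univ.erase k, weight (x j) :=
      Finset.sum_nonneg fun j hj => (hw j hj).le
    have h2 : ∑ j ∈ Finset.univ.erase k, weight (x j) * q j = -weight (x k) * q k := by linarith
    rw [h2] at hcs
    have h3 : 0 < -weight (x k) := by linarith
    have h4 : (-weight (x k)) * (-weight (x k) * q k ^ 2) ≤ (-weight (x k)) * A := by
      have := mul_le_mul_of_nonneg_right h1.le hA
      nlinarith
    have := le_of_mul_le_mul_left h4 h3
    linarith

/-- The integrand `G_f (x)`, as a quadratic form in the partial derivatives `a` of `f`. It depends only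
on the differences `aᵢ - aⱼ`. -/
noncomputable def dualForm {m : ℕ} (x a : Fin m → ℝ) : ℝ :=
  (∑ k, weight (x k))⁻¹ * ∑ p : Fin m × Fin m with p.1 < p.2,
    weight (x p.1) * weight (x p.2) * (a p.1 - a p.2) ^ 2

/-- `dualForm x a` is the (unnormalized) weighted variance of `a`, with weighted mean `μ`. -/
theorem exists_dualForm_eq {m : ℕ} [NeZero m] {x : Fin m → ℝ} (hx : ∀ k, 0 < x k)
    (hs : ∑ k, x k = 1) (hne : ∀ k, x k ≠ 1 / 2) (a : Fin m → ℝ) :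
    ∃ μ, dualForm x a = ∑ k, weight (x k) * (a k - μ) ^ 2 ∧
      ∑ k, weight (x k) * (a k - μ) = 0 := by
  have hW := sum_weight_ne_zero hx hs hne
  refine ⟨(∑ k, weight (x k) * a k) / ∑ k, weight (x k), ?_, ?_⟩
  · have h : ∀ k μ, weight (x k) * (a k - μ) ^ 2
        = weight (x k) * a k ^ 2 - 2 * μ * (weight (x k) * a k) + μ ^ 2 * weight (x k) :=
      fun k μ => by ring
    rw [dualForm, sum_lt_prod_eq (fun k => weight (x k)) a]
    simp only [h, Finset.sum_add_distrib, Finset.sum_sub_distrib, ← Finset.mul_sum]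
    field_simp
    ring
  · simp only [mul_sub, Finset.sum_sub_distrib, ← Finset.sum_mul]
    field_simp
    ring

theorem dualForm_nonneg {m : ℕ} [NeZero m] {x : Fin m → ℝ} (hx : ∀ k, 0 < x k)
    (hs : ∑ k, x k = 1) (hne : ∀ k, x k ≠ 1 / 2) (a : Fin m → ℝ) : 0 ≤ dualForm x a := by
  obtain ⟨μ, h1, h2⟩ := exists_dualForm_eq hx hs hne a
  rw [h1]
  exact sum_weight_mul_sq_nonneg hx hs hne h2

/-- Young's inequality for `dualForm` and its dual `∑ Vₖ² (1 - 2 xₖ) / xₖ²`, where `Vₖ = xₖ cₖ`. -/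
theorem pairing_le {m : ℕ} [NeZero m] {x : Fin m → ℝ} (hx : ∀ k, 0 < x k)
    (hs : ∑ k, x k = 1) (hne : ∀ k, x k ≠ 1 / 2) (a c : Fin m → ℝ) (hc : ∑ k, x k * c k = 0) :
    -∑ k, x k * c k * a k ≤ 2 * dualForm x a + (∑ k, c k ^ 2 * (1 - 2 * x k)) / 8 := by
  obtain ⟨μ, h1, h2⟩ := exists_dualForm_eq hx hs hne a
  have hw : ∀ k, weight (x k) * (c k * (1 - 2 * x k) / x k) = x k * c k := fun k => by
    have h1 : 1 - 2 * x k ≠ 0 := fun h => hne k (by linarith)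
    rw [weight, div_mul_div_comm, div_eq_iff (mul_ne_zero h1 (hx k).ne')]
    ring
  have hw2 : ∀ k, weight (x k) * (c k * (1 - 2 * x k) / x k) ^ 2 = c k ^ 2 * (1 - 2 * x k) :=
    fun k => by
      rw [sq, ← mul_assoc, hw]
      have := (hx k).ne'
      field_simp
  -- completing the square: the minimum over `a` is at `a - μ = -V / (4 w)`
  have h3 := sum_weight_mul_sq_nonneg hx hs hne
    (q := fun k => (a k - μ) + (c k * (1 - 2 * x k) / x k) / 4) (by
      have : ∀ k, weight (x k) * ((a k - μ) + (c k * (1 - 2 * x k) / x k) / 4)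
          = weight (x k) * (a k - μ) + x k * c k / 4 := fun k => by rw [← hw k]; ring
      simp only [this, Finset.sum_add_distrib, h2, ← Finset.sum_div, hc]
      ring)
  have h4 : ∀ k, weight (x k) * ((a k - μ) + (c k * (1 - 2 * x k) / x k) / 4) ^ 2
      = weight (x k) * (a k - μ) ^ 2 + (x k * c k * a k) / 2 - μ / 2 * (x k * c k)
        + c k ^ 2 * (1 - 2 * x k) / 16 := fun k => by
    rw [← hw2 k, ← hw k]; ring
  simp only [h4, Finset.sum_add_distrib, Finset.sum_sub_distrib, ← Finset.mul_sum, hc, ← h1,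
    ← Finset.sum_div] at h3
  linarith

/-! ### Passing to the corner simplex -/

theorem simplexEnergy_eq (f : (Fin (n + 1) → ℝ) → ℝ) (x a : Fin (n + 1) → ℝ)
    (h : ∀ i j, edgeDeriv f i j x = a i - a j) : simplexEnergy f x = dualForm x a := by
  simp only [simplexEnergy, dualForm, weight, h, sq_abs, div_mul_div_comm]

/-- The linear part of `simplexLift`. -/
def liftLinear (n : ℕ) : (Fin n → ℝ) →ₗ[ℝ] (Fin (n + 1) → ℝ) where
  toFun y := Fin.cons (-∑ i, y i) y
  map_add' y z := by
    ext l
    refine Fin.cases ?_ (fun i => ?_) l <;> simp [Finset.sum_add_distrib]; ring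
  map_smul' a y := by
    ext l
    refine Fin.cases ?_ (fun i => ?_) l <;> simp [Finset.mul_sum]

theorem simplexLift_eq (y : Fin n → ℝ) : simplexLift n y = liftLinear n y + Pi.single 0 1 := by
  ext l
  refine Fin.cases ?_ (fun i => ?_) l
  · simp [simplexLift, liftLinear]; ring
  · simp [simplexLift, liftLinear]

theorem liftLinear_tail {v : Fin (n + 1) → ℝ} (hv : ∑ k, v k = 0) :
    liftLinear n (Fin.tail v) = v := by
  rw [Fin.sum_univ_succ] at hv
  ext l
  refine Fin.cases ?_ (fun i => ?_) l
  · simp [liftLinear, Fin.tail]; linarith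
  · simp [liftLinear, Fin.tail]

theorem exists_lipschitzWith_simplexLift (n : ℕ) : ∃ K, LipschitzWith K (simplexLift n) := by
  refine ⟨‖(liftLinear n).toContinuousLinearMap‖₊, fun y z => ?_⟩
  rw [simplexLift_eq, simplexLift_eq, edist_add_right]
  exact (liftLinear n).toContinuousLinearMap.lipschitz y z

theorem measurableEmbedding_simplexLift (n : ℕ) : MeasurableEmbedding (simplexLift n) := by
  obtain ⟨K, hK⟩ := exists_lipschitzWith_simplexLift n
  refine hK.continuous.measurableEmbedding fun y z h => ?_
  ext i
  simpa [simplexLift] using congrFun h i.succ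

theorem edgeDeriv_simplexLift {f : (Fin (n + 1) → ℝ) → ℝ} {F : (Fin n → ℝ) → ℝ}
    (hF : Set.EqOn F (f ∘ simplexLift n) (cornerSimplex n)) {y : Fin n → ℝ}
    (hy : y ∈ cornerSimplex n) (i j : Fin (n + 1)) :
    edgeDeriv f i j (simplexLift n y)
      = lineDeriv ℝ F y (Fin.tail (Pi.single i 1 - Pi.single j 1 : Fin (n + 1) → ℝ)) := by
  have h1 : F =ᶠ[nhds y] f ∘ simplexLift n :=
    Filter.eventuallyEq_of_mem ((isOpen_cornerSimplex n).mem_nhds hy) hF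
  rw [h1.lineDeriv_eq, edgeDeriv, lineDeriv, lineDeriv]
  congr 1
  ext t
  have h2 : liftLinear n (Fin.tail (Pi.single i 1 - Pi.single j 1 : Fin (n + 1) → ℝ))
      = (Pi.single i 1 - Pi.single j 1 : Fin (n + 1) → ℝ) :=
    liftLinear_tail (by simp [Finset.sum_sub_distrib])
  rw [Function.comp_apply, simplexLift_eq, simplexLift_eq, map_add, map_smul, h2]
  congr 1; abel

theorem tail_single_succ (i : Fin n) :
    Fin.tail (Pi.single i.succ 1 : Fin (n + 1) → ℝ) = Pi.single i 1 := by
  ext j; simp [Fin.tail, Pi.single_apply]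

theorem tail_single_zero : Fin.tail (Pi.single 0 1 : Fin (n + 1) → ℝ) = 0 := by
  ext j; simp [Fin.tail]

/-- Almost everywhere no coordinate is `1/2`. For `n = 1` both coordinates are `1/2` at the same
point, where the weights degenerate. -/
theorem ae_simplexLift_ne (hn : 1 ≤ n) : ∀ᵐ y : Fin n → ℝ, ∀ l, simplexLift n y l ≠ 1 / 2 := by
  rw [ae_all_iff]
  -- a level set of a nonzero linear form is a proper affine subspace
  have key : ∀ (L : (Fin n → ℝ) →ₗ[ℝ] ℝ) (b : ℝ), L ≠ 0 → ∀ᵐ y : Fin n → ℝ, L y ≠ b := by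
    intro L b hL
    obtain ⟨y₀, hy₀⟩ : ∃ y₀, L y₀ ≠ b := by
      by_contra h
      push Not at h
      refine hL (LinearMap.ext fun y => ?_)
      have h1 := h (y + 0); have h2 := h 0
      rw [map_add, h2] at h1; simpa using h1
    let A : AffineSubspace ℝ (Fin n → ℝ) := (AffineSubspace.mk' b ⊥).comap L.toAffineMap
    have hA : A ≠ ⊤ := fun h => hy₀ (by
      have : y₀ ∈ A := by rw [h]; trivial
      simpa [A, sub_eq_zero] using this)
    refine measure_mono_null (fun y hy => ?_) (Measure.addHaar_affineSubspace volume A hA)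
    simp only [ne_eq, Set.mem_compl_iff, Set.mem_ofPred_eq, not_not] at hy
    simp [A, hy]
  intro l
  refine Fin.cases ?_ (fun i => ?_) l
  · have := key (∑ i, LinearMap.proj i) (1 / 2) (fun h => by
      have := LinearMap.congr_fun h (Pi.single ⟨0, hn⟩ 1)
      simp at this)
    filter_upwards [this] with y hy h
    refine hy ?_
    simp only [simplexLift, Fin.cons_zero] at h
    simp only [LinearMap.sum_apply, LinearMap.proj_apply]
    linarith
  · exact key (LinearMap.proj i) (1 / 2) (fun h => by
      have := LinearMap.congr_fun h (Pi.single i 1)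
      simp at this)

/-! ### Density of polynomials and the Poincaré inequality -/

theorem exists_mvPolynomial_near {F : (Fin n → ℝ) → ℝ} (hF : Continuous F) {ε : ℝ} (hε : 0 < ε) :
    ∃ p : MvPolynomial (Fin n) ℝ, ∀ y ∈ cornerSimplex n, |F y - eval y p| < ε := by
  let K : Set (Fin n → ℝ) := Set.Icc 0 1
  have : CompactSpace K := isCompact_iff_compactSpace.1 isCompact_Icc
  let φ : MvPolynomial (Fin n) ℝ →ₐ[ℝ] C(K, ℝ) :=
    aeval fun i => ⟨fun y => y.1 i, (continuous_apply i).comp continuous_subtype_val⟩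
  have hφ : ∀ p (y : K), φ p y = eval y.1 p := by
    intro p y
    induction p using MvPolynomial.induction_on with
    | C a => simp [φ]
    | add p q hp hq => simp [hp, hq]
    | mul_X p j hp => simp only [map_mul, ContinuousMap.mul_apply, hp]; simp [φ]
  have hsep : φ.range.SeparatesPoints := by
    intro y z hyz
    obtain ⟨i, hi⟩ : ∃ i, y.1 i ≠ z.1 i := by
      by_contra h
      push Not at h
      exact hyz (Subtype.ext (funext h))
    exact ⟨φ (X i), ⟨φ (X i), ⟨X i, rfl⟩, rfl⟩, by simpa [hφ] using hi⟩
  obtain ⟨⟨_, ⟨p, rfl⟩⟩, hp⟩ :=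
    ContinuousMap.exists_mem_subalgebra_near_continuous_of_separatesPoints φ.range hsep
      (fun y : K => F y.1) (hF.comp continuous_subtype_val) ε hε
  refine ⟨p, fun y hy => ?_⟩
  have h := hp ⟨y, cornerSimplex_subset_Icc n hy⟩
  have h2 : φ p ⟨y, cornerSimplex_subset_Icc n hy⟩ = eval y p := hφ p _
  rw [abs_sub_comm, ← h2]
  exact h

/-- `-∇F · A ∇u ≤ 2 G_F + ⅛ ∑ cₖ² (1 - 2 xₖ)`. -/
theorem pairing_grad_le {F : (Fin n → ℝ) → ℝ} {y : Fin n → ℝ} (hy : y ∈ cornerSimplex n)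
    (hne : ∀ l, simplexLift n y l ≠ 1 / 2) (a : Fin (n + 1) → ℝ) (ha : a 0 = 0)
    (haF : ∀ i : Fin n, a i.succ = lineDeriv ℝ F y (Pi.single i 1))
    (u : MvPolynomial (Fin n) ℝ) :
    -∑ i, lineDeriv ℝ F y (Pi.single i 1) * (y i * eval y (logGrad u i))
      ≤ 2 * dualForm (simplexLift n y) a
        + (∑ i, eval y (logGrad u i) ^ 2 + eval y (euler n u) ^ 2 - 2 * eval y (carre u)) / 8 := by
  obtain ⟨hpos, hsum⟩ := simplexLift_mem n hy
  set c : Fin (n + 1) → ℝ := Fin.cons (-eval y (euler n u)) fun i => eval y (logGrad u i) with hc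
  have hg := congrArg (eval y) (sum_grad u)
  simp only [grad, map_sum, map_mul, map_sub, map_one, eval_X] at hg
  have h := pairing_le hpos hsum hne a c (by
    rw [Fin.sum_univ_succ]
    simp only [simplexLift, hc, Fin.cons_zero, Fin.cons_succ]
    rw [hg]; ring)
  have h1 : ∑ k, simplexLift n y k * c k * a k
      = ∑ i, lineDeriv ℝ F y (Pi.single i 1) * (y i * eval y (logGrad u i)) := by
    rw [Fin.sum_univ_succ, ha, mul_zero, zero_add]
    refine Finset.sum_congr rfl fun i _ => ?_
    simp only [simplexLift, hc, Fin.cons_succ, haF]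
    ring
  have h2 : ∑ k, c k ^ 2 * (1 - 2 * simplexLift n y k)
      = ∑ i, eval y (logGrad u i) ^ 2 + eval y (euler n u) ^ 2 - 2 * eval y (carre u) := by
    have h3 : eval y (carre u) = ∑ i, y i * eval y (logGrad u i) ^ 2
        + eval y (euler n u) * ∑ i, y i * eval y (logGrad u i) := by
      rw [eval_carre, Finset.mul_sum, ← Finset.sum_add_distrib]
      refine Finset.sum_congr rfl fun i _ => ?_
      have : eval y (pderiv i u) = eval y (logGrad u i) + eval y (euler n u) := by
        rw [logGrad, map_sub]; ring
      rw [this]; ring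
    have h4 : ∀ i, eval y (logGrad u i) ^ 2 * (1 - 2 * y i)
        = eval y (logGrad u i) ^ 2 - 2 * (y i * eval y (logGrad u i) ^ 2) := fun i => by ring
    rw [Fin.sum_univ_succ, h3, hg]
    simp only [simplexLift, hc, Fin.cons_zero, Fin.cons_succ, h4, Finset.sum_sub_distrib,
      ← Finset.mul_sum]
    ring
  rw [h1, h2] at h
  exact h

/-- The inequality up to the `L²` distance to a polynomial `p`. The polynomial is first corrected by a
constant to make it `L u`; as `F` has mean zero, this only decreases the distance. -/
theorem integral_sq_le_add {C : NNReal} {F : (Fin n → ℝ) → ℝ} (hF : LipschitzWith C F)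
    (hF0 : ∫ y in cornerSimplex n, F y = 0) {G : (Fin n → ℝ) → ℝ}
    (hG : IntegrableOn G (cornerSimplex n))
    (hFG : ∀ u : MvPolynomial (Fin n) ℝ, ∀ᵐ y ∂volume.restrict (cornerSimplex n),
      -∑ i, lineDeriv ℝ F y (Pi.single i 1) * (y i * eval y (logGrad u i)) ≤ 2 * G y
        + (∑ i, eval y (logGrad u i) ^ 2 + eval y (euler n u) ^ 2 - 2 * eval y (carre u)) / 8)
    (p : MvPolynomial (Fin n) ℝ) :
    ∫ y in cornerSimplex n, F y ^ 2
      ≤ (∫ y in cornerSimplex n, (F y - eval y p) ^ 2) + 4 * ∫ y in cornerSimplex n, G y := by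
  obtain ⟨u, a, hu⟩ := exists_jacobiOp_eq p
  set q : (Fin n → ℝ) → ℝ := fun y => eval y (jacobiOp u) with hq
  have hqc : Continuous q := continuous_eval _
  have hpq : ∀ y, eval y p = q y - a := fun y => by simp [hq, hu]
  have hFc := hF.continuous
  have hIq : ∫ y in cornerSimplex n, q y = 0 := integral_div_eq_zero (tangent_logGrad u)
  have hibp := integral_by_parts hF (tangent_logGrad u)
  have hH : Continuous fun y => (∑ i, eval y (logGrad u i) ^ 2 + eval y (euler n u) ^ 2
      - 2 * eval y (carre u)) / 8 :=
    (((continuous_finsetSum _ fun i _ => (continuous_eval _).pow 2).add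
      ((continuous_eval _).pow 2)).sub (continuous_const.mul (continuous_eval _))).div_const 8
  have hFq : ∫ y in cornerSimplex n, F y * q y
      ≤ 2 * (∫ y in cornerSimplex n, G y) + (∫ y in cornerSimplex n, q y ^ 2) / 2 := by
    have h1 : ∫ y in cornerSimplex n, F y * q y = ∫ y in cornerSimplex n,
        -∑ i, lineDeriv ℝ F y (Pi.single i 1) * (y i * eval y (logGrad u i)) := by
      rw [integral_neg, hibp, neg_neg]; rfl
    rw [h1]
    have hi : IntegrableOn (fun y => -∑ i, lineDeriv ℝ F y (Pi.single i 1)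
        * (y i * eval y (logGrad u i))) (cornerSimplex n) := by
      refine (integrable_finsetSum _ fun i _ => ?_).neg
      refine (integrableOn_cornerSimplex
        ((continuous_apply i).mul (continuous_eval (logGrad u i)))).bdd_mul
        (c := C * ‖(Pi.single i 1 : Fin n → ℝ)‖)
        (measurable_lineDeriv hFc).aestronglyMeasurable
        (Filter.Eventually.of_forall fun y => norm_lineDeriv_le_of_lipschitz ℝ hF)
    have h2 := integral_mono_ae hi ((hG.const_mul 2).add (integrableOn_cornerSimplex hH)) (hFG u)
    refine h2.trans ?_
    simp only [Pi.add_apply]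
    rw [integral_add (hG.const_mul 2) (integrableOn_cornerSimplex hH), integral_const_mul,
      integral_div]
    have h3 := integral_bochner u
    linarith
  have h4 : ∫ y in cornerSimplex n, (F y - eval y p) ^ 2
      = ∫ y in cornerSimplex n, (((F y ^ 2 - 2 * (F y * q y)) + q y ^ 2)
        + (2 * a * F y - 2 * a * q y)) + a ^ 2 := by
    congr 1; ext y; rw [hpq]; ring
  have hi1 : IntegrableOn (fun y => F y ^ 2) (cornerSimplex n) :=
    integrableOn_cornerSimplex (hFc.pow 2)
  have hi2 : IntegrableOn (fun y => 2 * (F y * q y)) (cornerSimplex n) :=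
    integrableOn_cornerSimplex (continuous_const (y := (2 : ℝ)) |>.mul (hFc.mul hqc))
  have hi3 : IntegrableOn (fun y => q y ^ 2) (cornerSimplex n) :=
    integrableOn_cornerSimplex (hqc.pow 2)
  have hi4 : IntegrableOn (fun y => 2 * a * F y) (cornerSimplex n) :=
    integrableOn_cornerSimplex (continuous_const (y := 2 * a) |>.mul hFc)
  have hi5 : IntegrableOn (fun y => 2 * a * q y) (cornerSimplex n) :=
    integrableOn_cornerSimplex (continuous_const (y := 2 * a) |>.mul hqc)
  have hi6 := integrableOn_cornerSimplex (n := n) (continuous_const (y := a ^ 2))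
  have h5 : 0 ≤ ∫ y in cornerSimplex n, a ^ 2 := integral_nonneg fun _ => sq_nonneg a
  have hj1 : IntegrableOn (fun y => F y ^ 2 - 2 * (F y * q y)) (cornerSimplex n) := hi1.sub hi2
  have hj2 : IntegrableOn (fun y => F y ^ 2 - 2 * (F y * q y) + q y ^ 2) (cornerSimplex n) :=
    hj1.add hi3
  have hj3 : IntegrableOn (fun y => 2 * a * F y - 2 * a * q y) (cornerSimplex n) := hi4.sub hi5
  have hj4 : IntegrableOn (fun y => F y ^ 2 - 2 * (F y * q y) + q y ^ 2
    + (2 * a * F y - 2 * a * q y)) (cornerSimplex n) := hj2.add hj3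
  rw [h4, integral_add hj4 hi6, integral_add hj2 hj3, integral_add hj1 hi3,
    integral_sub hi1 hi2, integral_sub hi4 hi5, integral_const_mul, integral_const_mul,
    integral_const_mul, hIq, hF0]
  linarith

/-- The Poincaré inequality, with any integrable `G` that satisfies Young's inequality with the
fields `A ∇u`. -/
theorem integral_sq_le {C : NNReal} {F : (Fin n → ℝ) → ℝ} (hF : LipschitzWith C F)
    (hF0 : ∫ y in cornerSimplex n, F y = 0) {G : (Fin n → ℝ) → ℝ}
    (hG : IntegrableOn G (cornerSimplex n))
    (hFG : ∀ u : MvPolynomial (Fin n) ℝ, ∀ᵐ y ∂volume.restrict (cornerSimplex n),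
      -∑ i, lineDeriv ℝ F y (Pi.single i 1) * (y i * eval y (logGrad u i)) ≤ 2 * G y
        + (∑ i, eval y (logGrad u i) ^ 2 + eval y (euler n u) ^ 2 - 2 * eval y (carre u)) / 8) :
    ∫ y in cornerSimplex n, F y ^ 2 ≤ 4 * ∫ y in cornerSimplex n, G y := by
  have h : ∀ ε : ℝ, 0 < ε → ∫ y in cornerSimplex n, F y ^ 2
      ≤ ε ^ 2 * volume.real (cornerSimplex n) + 4 * ∫ y in cornerSimplex n, G y := by
    intro ε hε
    obtain ⟨p, hp⟩ := exists_mvPolynomial_near hF.continuous hε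
    refine (integral_sq_le_add hF hF0 hG hFG p).trans (add_le_add ?_ le_rfl)
    have h1 := setIntegral_mono_on
      (integrableOn_cornerSimplex ((hF.continuous.sub (continuous_eval p)).pow 2))
      (integrableOn_cornerSimplex (continuous_const (y := ε ^ 2)))
      (isOpen_cornerSimplex n).measurableSet
      (fun y hy => sq_le_sq' (neg_lt_of_abs_lt (hp y hy)).le (lt_of_abs_lt (hp y hy)).le)
    refine h1.trans_eq ?_
    rw [setIntegral_const, smul_eq_mul, mul_comm]
  have hl : Filter.Tendsto (fun ε : ℝ => ε ^ 2 * volume.real (cornerSimplex n)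
      + 4 * ∫ y in cornerSimplex n, G y) (nhdsWithin 0 (Set.Ioi 0))
      (nhds (0 ^ 2 * volume.real (cornerSimplex n) + 4 * ∫ y in cornerSimplex n, G y)) := by
    refine Filter.Tendsto.mono_left ?_ nhdsWithin_le_nhds
    exact Continuous.tendsto (by fun_prop) 0
  have h2 := ge_of_tendsto hl (by
    filter_upwards [self_mem_nhdsWithin] with ε hε using h ε hε)
  simpa using h2

end SimplexPoincare

open SimplexPoincare in
theorem theorem4p3 (n : ℕ) (hn : 1 ≤ n) (f : (Fin (n + 1) → ℝ) → ℝ) (C : NNReal)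
    (hf : LipschitzOnWith C f (openSimplex n))
    (hf0 : ∫ x, f x ∂(simplexMeasure n) = 0) :
    (∀ᵐ x ∂(simplexMeasure n), 0 ≤ simplexEnergy f x) ∧
    ∫⁻ x, ENNReal.ofReal (f x ^ 2) ∂(simplexMeasure n) ≤
      4 * ∫⁻ x, ENNReal.ofReal (simplexEnergy f x) ∂(simplexMeasure n) := by
  have hemb := measurableEmbedding_simplexLift n
  have hS := (isOpen_cornerSimplex n).measurableSet
  obtain ⟨g, hg, hfg⟩ := hf.extend_real
  obtain ⟨K, hK⟩ := exists_lipschitzWith_simplexLift n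
  set F : (Fin n → ℝ) → ℝ := g ∘ simplexLift n with hFdef
  have hF : LipschitzWith (C * K) F := hg.comp hK
  have hFf : Set.EqOn F (f ∘ simplexLift n) (cornerSimplex n) := fun y hy =>
    (hfg (simplexLift_mem n hy)).symm
  have hne : ∀ᵐ y ∂volume.restrict (cornerSimplex n), ∀ l, simplexLift n y l ≠ 1 / 2 :=
    ae_restrict_of_ae (ae_simplexLift_ne hn)
  -- `a y k - a y l` is the derivative of `F` in the direction `e_k - e_l`; `a y 0 = 0`.
  set a : (Fin n → ℝ) → Fin (n + 1) → ℝ := fun y k =>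
    fderiv ℝ F y (Fin.tail (Pi.single k 1 : Fin (n + 1) → ℝ)) with ha
  have hE : ∀ᵐ y ∂volume.restrict (cornerSimplex n),
      simplexEnergy f (simplexLift n y) = dualForm (simplexLift n y) (a y) := by
    filter_upwards [ae_restrict_mem hS, ae_restrict_of_ae hF.ae_differentiableAt] with y hy hd
    refine simplexEnergy_eq f _ _ fun i j => ?_
    rw [edgeDeriv_simplexLift hFf hy, hd.lineDeriv_eq_fderiv, ← map_sub]
    rfl
  have hE0 : ∀ᵐ y ∂volume.restrict (cornerSimplex n), 0 ≤ simplexEnergy f (simplexLift n y) := by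
    filter_upwards [hE, hne, ae_restrict_mem hS] with y h1 h2 hy
    rw [h1]
    exact dualForm_nonneg (simplexLift_mem n hy).1 (simplexLift_mem n hy).2 h2 _
  refine ⟨by rw [simplexMeasure, hemb.ae_map_iff]; exact hE0, ?_⟩
  rw [simplexMeasure, hemb.lintegral_map, hemb.lintegral_map]
  have hFsq : ∫⁻ y in cornerSimplex n, ENNReal.ofReal (f (simplexLift n y) ^ 2)
      = ENNReal.ofReal (∫ y in cornerSimplex n, F y ^ 2) := by
    have hi : IntegrableOn (fun y => F y ^ 2) (cornerSimplex n) :=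
      integrableOn_cornerSimplex (hF.continuous.pow 2)
    rw [ofReal_integral_eq_lintegral_ofReal hi (Filter.Eventually.of_forall fun _ => sq_nonneg _)]
    refine setLIntegral_congr_fun hS fun y hy => ?_
    simp only [hFf hy, Function.comp_apply]
  have hF0 : ∫ y in cornerSimplex n, F y = 0 := by
    rw [simplexMeasure, hemb.integral_map] at hf0
    rw [← hf0]
    exact setIntegral_congr_fun hS hFf
  by_cases htop : ∫⁻ y in cornerSimplex n, ENNReal.ofReal (simplexEnergy f (simplexLift n y)) = ⊤
  · rw [htop, ENNReal.mul_top (by norm_num)]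
    exact le_top
  have hmeas : AEStronglyMeasurable (fun y => simplexEnergy f (simplexLift n y))
      (volume.restrict (cornerSimplex n)) := by
    have hm : Measurable fun y => dualForm (simplexLift n y) (a y) := by
      have hl : ∀ k, Measurable fun y => simplexLift n y k := fun k =>
        (measurable_pi_apply k).comp (measurable_simplexLift n)
      have hak : ∀ k, Measurable fun y => a y k := fun k => measurable_fderiv_apply_const ℝ F _
      simp only [dualForm, weight]
      fun_prop
    exact hm.aestronglyMeasurable.congr (hE.mono fun y hy => hy.symm)
  have hG : IntegrableOn (fun y => simplexEnergy f (simplexLift n y)) (cornerSimplex n) :=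
    (lintegral_ofReal_ne_top_iff_integrable hmeas hE0).1 htop
  have hmain := integral_sq_le hF hF0 hG fun u => by
    filter_upwards [hE, hne, ae_restrict_mem hS, ae_restrict_of_ae hF.ae_differentiableAt]
      with y h1 h2 hy hd
    rw [h1]
    refine pairing_grad_le hy h2 (a y) ?_ (fun i => ?_) u
    · simp only [ha, tail_single_zero, map_zero]
    · simp only [ha, tail_single_succ, hd.lineDeriv_eq_fderiv]
  rw [hFsq, ← ofReal_integral_eq_lintegral_ofReal hG hE0]
  refine (ENNReal.ofReal_le_ofReal hmain).trans_eq ?_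
  rw [ENNReal.ofReal_mul (by norm_num)]
  norm_num
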